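/- Let $n\ge 2$ and $a<b$, let $\gamma\in C^\infty([a,b];\mathbb{R}^n)$ be parametrized by arc-length, i.e. $|\gamma'|\equiv 1$, with unit tangent $T=\gamma'$, and let $\varrho\in C^\infty([a,b];\mathbb{R}_{>0})$ be a bending stiffness. For a smooth regular curve $\eta:[a,b]\to\mathbb{R}^n$ write $\mathcal{B}_\varrho(\eta)=\tfrac12\int_a^b\varrho\,\big\langle\tfrac{dT_\eta}{ds},\tfrac{dT_\eta}{ds}\big\rangle\,ds$, where $\tfrac{d}{ds}=\tfrac{1}{|\eta'|}\tfrac{d}{dx}$, $T_\eta=\tfrac{d\eta}{ds}$ and $ds=|\eta'|\,dx$. The curve $\gamma$ is called elastic with bending stiffness $\varrho$ if $\tfrac{d}{dt}\big|_{t=0}\mathcal{B}_\varrho(\gamma_t)=0$ for every family $(\gamma_t)_{t\in[-\epsilon,\epsilon]}$, $\epsilon>0$, of arc-length parametrized curves with $\gamma_0=\gamma$ such that $(t,x)\mapsto\gamma_t(x)$ is smooth on $[-\epsilon,\epsilon]\times[a,b]$ and, for some $\delta>0$, $\gamma_t(x)=\gamma(x)$ for all $t$ and all $x\in[a,a+\delta]\cup[b-\delta,b]$.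 Let $N=[N_1,\dots,N_{n-1}]$ consist of parallel unit normal fields along $\gamma$ (smooth, $|N_i|=1$, $\langle N_i,T\rangle=0$, $N_i'=\lambda_iT$ with $\lambda_i\in C^\infty([a,b])$) with $\det(T,N_1,\dots,N_{n-1})=1$, and let $\kappa\in C^\infty([a,b];\mathbb{R}^{n-1})$ be the curvature function of $\gamma$ with respect to $N$, defined by $T'=-N\kappa$. Then $\gamma$ is elastic with bending stiffness $\varrho$ if and only if there is a function $\Lambda\in C^\infty([a,b];\mathbb{R})$ such that, on $[a,b]$, $$(\varrho\kappa)''+\tfrac12\varrho\langle\kappa,\kappa\rangle\kappa-\Lambda\kappa=0\qquad\text{and}\qquad \Lambda'+\tfrac12\varrho'\langle\kappa,\kappa\rangle=0 .$$ -/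

import Mathlib

open scoped ContDiff

noncomputable section

namespace ElasticCurve

/-- The derivative of a map on `[a,b]` (one-sided at the end points). -/
def D {F : Type*} [NormedAddCommGroup F] [NormedSpace ℝ F] (a b : ℝ) (f : ℝ → F) : ℝ → F :=
  derivWithin f (Set.Icc a b)

/-- `f ∈ C^∞([a,b]; F)`; only the values of `f` on `[a,b]` matter. -/
def SmoothOn {F : Type*} [NormedAddCommGroup F] [NormedSpace ℝ F] (a b : ℝ) (f : ℝ → F) : Prop :=
  ContDiffOn ℝ ∞ f (Set.Icc a b)

/-- The derivative `dg/ds = g' / |γ'|` with respect to the arc-length of `γ`. -/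
def arcDeriv {n : ℕ} {F : Type*} [NormedAddCommGroup F] [NormedSpace ℝ F] (a b : ℝ)
    (γ : ℝ → EuclideanSpace ℝ (Fin n)) (g : ℝ → F) (x : ℝ) : F :=
  ‖D a b γ x‖⁻¹ • D a b g x

/-- The unit tangent field `T = dγ/ds`. -/
def tangent {n : ℕ} (a b : ℝ) (γ : ℝ → EuclideanSpace ℝ (Fin n)) : ℝ → EuclideanSpace ℝ (Fin n) :=
  arcDeriv a b γ γ

/-- `γ` is a smooth curve on `[a,b]` with `|γ'| = 1`. -/
def IsArcLengthCurve {n : ℕ} (a b : ℝ) (γ : ℝ → EuclideanSpace ℝ (Fin n)) : Prop :=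
  SmoothOn a b γ ∧ ∀ x ∈ Set.Icc a b, ‖D a b γ x‖ = 1

/-- The bending energy `½ ∫ ϱ ⟨dT/ds, dT/ds⟩ ds` (with `ds = |γ'| dx`) with bending stiffness `ϱ`. -/
def bendingEnergy {n : ℕ} (a b : ℝ) (ϱ : ℝ → ℝ) (γ : ℝ → EuclideanSpace ℝ (Fin n)) : ℝ :=
  (1 / 2) * ∫ x in a..b,
    ϱ x * inner ℝ (arcDeriv a b γ (tangent a b γ) x) (arcDeriv a b γ (tangent a b γ) x)
      * ‖D a b γ x‖

/-- `t ↦ Γ t`, `t ∈ [-ε,ε]`, is a smooth variation of `γ` with compact support in the interior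
of `[a,b]`. -/
structure IsVariation {n : ℕ} (a b : ℝ) (γ : ℝ → EuclideanSpace ℝ (Fin n))
    (ε : ℝ) (Γ : ℝ → ℝ → EuclideanSpace ℝ (Fin n)) : Prop where
  pos : 0 < ε
  smooth : ContDiffOn ℝ ∞ (fun p : ℝ × ℝ => Γ p.1 p.2) (Set.Icc (-ε) ε ×ˢ Set.Icc a b)
  zero : ∀ x ∈ Set.Icc a b, Γ 0 x = γ x
  compact_support : ∃ δ > 0, ∀ t ∈ Set.Icc (-ε) ε, ∀ x ∈ Set.Icc a b,
    (x ≤ a + δ ∨ b - δ ≤ x) → Γ t x = γ x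

/-- The arc-length parametrized curve `γ` is elastic with bending stiffness `ϱ`: it is a critical
point of the bending energy under all compactly supported variations through arc-length
parametrized curves. -/
def IsElastic {n : ℕ} (a b : ℝ) (ϱ : ℝ → ℝ) (γ : ℝ → EuclideanSpace ℝ (Fin n)) : Prop :=
  ∀ (ε : ℝ) (Γ : ℝ → ℝ → EuclideanSpace ℝ (Fin n)), IsVariation a b γ ε Γ →
    (∀ t ∈ Set.Icc (-ε) ε, IsArcLengthCurve a b (Γ t)) →
    HasDerivAt (fun t => bendingEnergy a b ϱ (Γ t)) 0 0

/-- `Z` is a parallel normal field along `γ`: `⟨Z, T⟩ = 0` and `Z' = lam T` with `lam` smooth. -/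
def IsParallelNormalField {n : ℕ} (a b : ℝ) (γ Z : ℝ → EuclideanSpace ℝ (Fin n)) : Prop :=
  SmoothOn a b Z ∧
  (∀ x ∈ Set.Icc a b, inner ℝ (Z x) (tangent a b γ x) = 0) ∧
  ∃ lam : ℝ → ℝ, SmoothOn a b lam ∧
    ∀ x ∈ Set.Icc a b, D a b Z x = lam x • tangent a b γ x

/-- The matrix with columns `T, N₁, …, N_m` at the parameter `x`. -/
def frameMatrix {m : ℕ} (a b : ℝ) (γ : ℝ → EuclideanSpace ℝ (Fin (m + 1)))
    (N : Fin m → ℝ → EuclideanSpace ℝ (Fin (m + 1))) (x : ℝ) :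
    Matrix (Fin (m + 1)) (Fin (m + 1)) ℝ :=
  Matrix.of fun i j =>
    (Fin.cons (tangent a b γ x) (fun k => N k x) : Fin (m + 1) → EuclideanSpace ℝ (Fin (m + 1))) j i

/-- `N = [N₁, …, N_m]` is made of parallel unit normal fields along the curve `γ` in `ℝ^(m+1)`
and `det(T, N₁, …, N_m) = 1`. As all columns have length one, the determinant condition makes the
frame orthonormal. -/
structure IsParallelFrame {m : ℕ} (a b : ℝ) (γ : ℝ → EuclideanSpace ℝ (Fin (m + 1)))
    (N : Fin m → ℝ → EuclideanSpace ℝ (Fin (m + 1))) : Prop where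
  parallel : ∀ i, IsParallelNormalField a b γ (N i)
  unit : ∀ i, ∀ x ∈ Set.Icc a b, ‖N i x‖ = 1
  det_eq_one : ∀ x ∈ Set.Icc a b, (frameMatrix a b γ N x).det = 1

/-- `κ` is the curvature function of `γ` with respect to `N`: `κ` is smooth and `T' = -Nκ`. -/
def IsCurvatureFunction {m : ℕ} (a b : ℝ) (γ : ℝ → EuclideanSpace ℝ (Fin (m + 1)))
    (N : Fin m → ℝ → EuclideanSpace ℝ (Fin (m + 1))) (κ : ℝ → EuclideanSpace ℝ (Fin m)) : Prop :=
  SmoothOn a b κ ∧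
  ∀ x ∈ Set.Icc a b, D a b (tangent a b γ) x = -∑ i, κ x i • N i x

end ElasticCurve

end

/-! Let `w` be the `t`-derivative at `t = 0` of the tangents of an admissible variation. Constant
speed forces `w ⊥ T`, and fixed ends force `∫ w = 0`. After an integration by parts the first
variation of the energy is `-∫ ⟨(ϱT')', w⟩` (`exists_firstVariation`). Hence `γ` should be critical
exactly when the normal part of `(ϱT')'` is the normal part of a constant vector `c`, the Lagrange
multiplier of the closing condition `∫ w = 0`.

In the parallel frame `Nᵢ' = κᵢ T`, so `(ϱT')' = -∑ (ϱκ)'ᵢ Nᵢ - ϱ|κ|² T`, and the candidate for the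
constant is `c = μ T - ∑ (ϱκ)'ᵢ Nᵢ`. With `Λ = ½ϱ|κ|² - μ`, the normal and tangential components of
`c' = 0` are the two Euler-Lagrange equations (`HasMultiplier.exists_const`,
`hasMultiplier_of_const`).

The hard point is that enough fields `w` come from variations through arc-length curves
(`exists_isVariation`). A normal field is added to `T`, the result is renormalized and integrated,
and the end point is restored by corrections `φ(v - ⟨v,T⟩T)` whose vector `v(t)` comes from the
implicit function theorem. This requires the corrections to span all end point displacements, which
holds near a point where `κ ≠ 0` (`eq_zero_of_integral_normal_eq_zero`). A straight segment is
treated separately. -/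

open MeasureTheory Set Filter Topology

/-! ### Tools: parametric integrals, implicit functions, Hadamard's equality case, cutoffs. -/

/-- The partial derivative of a parametric integral of a `C^1` function. -/
theorem hasFDerivAt_intervalIntegral_param {E F : Type*} [NormedAddCommGroup E] [NormedSpace ℝ E]
    [FiniteDimensional ℝ E] [NormedAddCommGroup F] [NormedSpace ℝ F]
    {f : E × ℝ → F} (hf : ContDiff ℝ 1 f) (a b : ℝ) (x₀ : E) :
    HasFDerivAt (fun x => ∫ t in a..b, f (x, t))
      (∫ t in a..b, (fderiv ℝ f (x₀, t)).comp (ContinuousLinearMap.inl ℝ E ℝ)) x₀ := by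
  have : ProperSpace E := FiniteDimensional.proper_real E
  have hf' : Continuous fun p : E × ℝ => (fderiv ℝ f p).comp (ContinuousLinearMap.inl ℝ E ℝ) :=
    (hf.continuous_fderiv one_ne_zero).clm_comp continuous_const
  obtain ⟨C, hC⟩ := ((isCompact_closedBall x₀ 1).prod
    (isCompact_uIcc (a := a) (b := b))).exists_bound_of_continuousOn hf'.continuousOn
  refine intervalIntegral.hasFDerivAt_integral_of_dominated_of_fderiv_le
    (F' := fun x t => (fderiv ℝ f (x, t)).comp (ContinuousLinearMap.inl ℝ E ℝ))
    (bound := fun _ => C) (Metric.closedBall_mem_nhds x₀ one_pos) ?_ ?_ ?_ ?_ ?_ ?_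
  · exact Eventually.of_forall fun x =>
      (hf.continuous.comp (Continuous.prodMk_right x)).aestronglyMeasurable
  · exact (hf.continuous.comp (Continuous.prodMk_right x₀)).intervalIntegrable _ _
  · exact (hf'.comp (Continuous.prodMk_right x₀)).aestronglyMeasurable
  · exact Eventually.of_forall fun t ht x hx => hC (x, t) ⟨hx, uIoc_subset_uIcc ht⟩
  · exact intervalIntegrable_const
  · refine Eventually.of_forall fun t _ x _ => ?_
    have h := (hf.differentiable one_ne_zero (x, t)).hasFDerivAt
    exact h.comp x (hasFDerivAt_prodMk_left x t)

/-- A parametric integral over a fixed interval of a smooth function is smooth. -/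
theorem contDiff_intervalIntegral_param_nat {E : Type} [NormedAddCommGroup E] [NormedSpace ℝ E]
    [FiniteDimensional ℝ E] (a b : ℝ) (n : ℕ) :
    ∀ {F : Type} [NormedAddCommGroup F] [NormedSpace ℝ F]
      {f : E × ℝ → F}, ContDiff ℝ n f → ContDiff ℝ n (fun x => ∫ t in a..b, f (x, t)) := by
  -- `F` stays universally quantified because the derivative is a parametric integral with values in
  -- `E →L[ℝ] F`.
  induction n with
  | zero =>
    intro F _ _ f hf
    rw [Nat.cast_zero, contDiff_zero] at hf ⊢
    exact intervalIntegral.continuous_parametric_intervalIntegral_of_continuous' (by fun_prop) a b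
  | succ n ih =>
    intro F _ _ f hf
    have h1 : ContDiff ℝ 1 f := hf.of_le (by push_cast; exact le_add_self)
    have hd := hasFDerivAt_intervalIntegral_param h1 a b
    push_cast at hf ⊢
    rw [contDiff_succ_iff_fderiv] at hf ⊢
    refine ⟨fun x => (hd x).differentiableAt, fun h => by simp at h, ?_⟩
    rw [show fderiv ℝ (fun x => ∫ t in a..b, f (x, t)) = _ from funext fun x => (hd x).fderiv]
    exact ih (f := fun p => (fderiv ℝ f p).comp (ContinuousLinearMap.inl ℝ E ℝ))
      (hf.2.2.clm_comp contDiff_const)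

theorem contDiff_intervalIntegral_param {E F : Type} [NormedAddCommGroup E] [NormedSpace ℝ E]
    [FiniteDimensional ℝ E] [NormedAddCommGroup F] [NormedSpace ℝ F]
    {f : E × ℝ → F} (hf : ContDiff ℝ ∞ f) (a b : ℝ) :
    ContDiff ℝ ∞ (fun x => ∫ t in a..b, f (x, t)) :=
  contDiff_infty.2 fun n => contDiff_intervalIntegral_param_nat a b n (contDiff_infty.1 hf n)

/-- The primitive of a smooth function depending smoothly on parameters is jointly smooth. -/
theorem contDiff_primitive_param {E F : Type} [NormedAddCommGroup E] [NormedSpace ℝ E]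
    [FiniteDimensional ℝ E] [NormedAddCommGroup F] [NormedSpace ℝ F]
    {f : E × ℝ → F} (hf : ContDiff ℝ ∞ f) (a : ℝ) :
    ContDiff ℝ ∞ (fun p : E × ℝ => ∫ t in a..p.2, f (p.1, t)) := by
  -- Rescaling to `[0,1]` turns the moving end point into one more parameter.
  have h : (fun p : E × ℝ => ∫ t in a..p.2, f (p.1, t)) =
      fun p : E × ℝ => (p.2 - a) • ∫ θ in (0 : ℝ)..1, f (p.1, a + (p.2 - a) * θ) := by
    funext p
    rw [intervalIntegral.smul_integral_comp_add_mul (fun y => f (p.1, y))]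
    simp
  rw [h]
  refine (contDiff_snd.sub contDiff_const).smul
    (contDiff_intervalIntegral_param
      (f := fun q : (E × ℝ) × ℝ => f (q.1.1, a + (q.1.2 - a) * q.2)) ?_ 0 1)
  exact hf.comp (by fun_prop)

/-- Smooth implicit functions of one real variable. -/
theorem exists_contDiffOn_implicit {E : Type*} [NormedAddCommGroup E] [NormedSpace ℝ E]
    [FiniteDimensional ℝ E] {G : ℝ × E → E} (hG : ContDiff ℝ ∞ G) (hG0 : G 0 = 0)
    (hinj : ∀ v : E, fderiv ℝ G 0 (0, v) = 0 → v = 0) :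
    ∃ ε > 0, ∃ v : ℝ → E, ContDiffOn ℝ ∞ v (Icc (-ε) ε) ∧ v 0 = 0 ∧
      ∀ t ∈ Icc (-ε) ε, G (t, v t) = 0 := by
  have : CompleteSpace E := FiniteDimensional.complete ℝ E
  -- The solution is the second component of the local inverse of `Φ` at `(t, 0)`.
  set Φ : ℝ × E → ℝ × E := fun p => (p.1, G p) with hΦ
  have hΦs : ContDiff ℝ ∞ Φ := contDiff_fst.prodMk hG
  have hd : ∀ p, HasFDerivAt Φ ((ContinuousLinearMap.fst ℝ ℝ E).prod (fderiv ℝ G p)) p := fun p =>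
    hasFDerivAt_fst.prodMk (hG.differentiable (by simp) p).hasFDerivAt
  set L := (ContinuousLinearMap.fst ℝ ℝ E).prod (fderiv ℝ G 0) with hL
  have hLinj : Function.Injective L := by
    rw [injective_iff_map_eq_zero]
    rintro ⟨t, v⟩ h
    simp only [hL, ContinuousLinearMap.prod_apply, ContinuousLinearMap.coe_fst', Prod.mk_eq_zero] at h
    obtain ⟨rfl, h⟩ := h
    rw [hinj v h, Prod.mk_zero_zero]
  let e : (ℝ × E) ≃L[ℝ] (ℝ × E) :=
    (LinearEquiv.ofInjectiveEndo (L : (ℝ × E) →ₗ[ℝ] (ℝ × E)) hLinj).toContinuousLinearEquiv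
  have he : (e : (ℝ × E) →L[ℝ] (ℝ × E)) = L := by ext p <;> rfl
  have h0 : HasFDerivAt Φ (e : (ℝ × E) →L[ℝ] (ℝ × E)) 0 := he ▸ hd 0
  set H := hΦs.contDiffAt.toOpenPartialHomeomorph Φ h0 (by simp) with hH
  have hHc : ∀ p, H p = Φ p := fun p => rfl
  have hΦ0 : Φ 0 = 0 := by simp [hΦ, hG0]
  have hsrc : (0 : ℝ × E) ∈ H.source := hΦs.contDiffAt.mem_toOpenPartialHomeomorph_source h0 (by simp)
  have htgt : (0 : ℝ × E) ∈ H.target := by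
    have := H.map_source hsrc
    rwa [hHc, hΦ0] at this
  have hsymm0 : H.symm 0 = 0 := by
    have := H.left_inv hsrc
    rwa [hHc, hΦ0] at this
  have hcont : ContinuousAt H.symm 0 := H.continuousAt_symm htgt
  -- Smoothness of the inverse is needed on a whole interval, not only at `0`; invertibility of the
  -- derivative persists nearby because invertible maps form an open set.
  have hev : ∀ᶠ y in 𝓝 (0 : ℝ × E), y ∈ H.target ∧ ∃ e' : (ℝ × E) ≃L[ℝ] (ℝ × E),
      (e' : (ℝ × E) →L[ℝ] (ℝ × E)) =
        (ContinuousLinearMap.fst ℝ ℝ E).prod (fderiv ℝ G (H.symm y)) := by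
    refine Filter.Eventually.and (H.open_target.mem_nhds htgt) ?_
    have hc : ContinuousAt (fun y => fderiv ℝ Φ (H.symm y)) 0 :=
      ((hΦs.continuous_fderiv (by simp)).continuousAt).comp hcont
    have hn : ∀ᶠ y in 𝓝 (0 : ℝ × E), fderiv ℝ Φ (H.symm y) ∈
        range ((↑) : ((ℝ × E) ≃L[ℝ] (ℝ × E)) → (ℝ × E) →L[ℝ] (ℝ × E)) := by
      refine hc.eventually_mem ?_
      simp only [hsymm0, h0.fderiv]
      exact ContinuousLinearEquiv.nhds e
    filter_upwards [hn] with y hy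
    obtain ⟨e', he'⟩ := hy
    exact ⟨e', by rw [he', (hd _).fderiv]⟩
  have hi : ContinuousAt (fun t : ℝ => (t, (0 : E))) 0 := by fun_prop
  obtain ⟨ε, hε, hball⟩ := Metric.eventually_nhds_iff.1 (hi.eventually (by exact hev))
  have hmem : ∀ t ∈ Icc (-(ε / 2)) (ε / 2), dist t 0 < ε := fun t ht => by
    rw [Real.dist_eq, sub_zero, abs_lt]; constructor <;> linarith [ht.1, ht.2]
  refine ⟨ε / 2, by positivity, fun t => (H.symm (t, 0)).2, ?_, ?_, ?_⟩
  · intro t ht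
    obtain ⟨h1, e', he'⟩ := hball (hmem t ht)
    have hs : ContDiffAt ℝ ∞ H.symm (t, (0 : E)) :=
      H.contDiffAt_symm h1 (he' ▸ hd _) hΦs.contDiffAt
    have : ContDiffAt ℝ ∞ (fun t : ℝ => (t, (0 : E))) t := by fun_prop
    exact (contDiff_snd.contDiffAt.comp t (hs.comp t this)).contDiffWithinAt
  · simp only [Prod.mk_zero_zero, hsymm0, Prod.snd_zero]
  · intro t ht
    obtain ⟨h1, -⟩ := hball (hmem t ht)
    have h := H.right_inv h1
    rw [hHc] at h
    simp only [hΦ, Prod.mk.injEq] at h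
    have h2 : (t, (H.symm (t, 0)).2) = H.symm (t, 0) := Prod.ext h.1.symm rfl
    show G (t, (H.symm (t, 0)).2) = 0
    rw [h2, h.2]

/-- The equality case of Hadamard's inequality: unit vectors spanning a unit volume are
orthonormal. -/
theorem orthonormal_of_det_eq_one {k : ℕ} (v : Fin k → EuclideanSpace ℝ (Fin k))
    (hv : ∀ i, ‖v i‖ = 1) (hdet : (Matrix.of fun i j => v j i).det = 1) : Orthonormal ℝ v := by
  set A : Matrix (Fin k) (Fin k) ℝ := Matrix.of fun i j => v j i with hA
  have hentry : ∀ i j, (A.transpose * A) i j = inner ℝ (v i) (v j) := fun i j => by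
    simp [Matrix.mul_apply, hA, PiLp.inner_apply, mul_comm]
  have hpsd : (A.transpose * A).PosSemidef := by
    simpa using Matrix.posSemidef_conjTranspose_mul_self A
  have hGdet : (A.transpose * A).det = 1 := by
    rw [Matrix.det_mul, Matrix.det_transpose, hdet, one_mul]
  have htr : (A.transpose * A).trace = k := by
    simp [Matrix.trace, hentry, hv]
  set lam := hpsd.isHermitian.eigenvalues with hlam
  have hprod : ∏ i, lam i = 1 := by
    have := hpsd.isHermitian.det_eq_prod_eigenvalues
    rw [hGdet] at this
    simpa using this.symm
  have hsum : ∑ i, lam i = k := by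
    have := hpsd.isHermitian.trace_eq_sum_eigenvalues
    rw [htr] at this
    simpa using this.symm
  have hpos : ∀ i, 0 < lam i := fun i => by
    refine lt_of_le_of_ne (hpsd.eigenvalues_nonneg i) fun h => ?_
    rw [Finset.prod_eq_zero (Finset.mem_univ i) h.symm] at hprod
    exact zero_ne_one hprod
  -- The Gram eigenvalues have sum `k` and product `1`. Each term `λ - 1 - log λ` is nonnegative and
  -- vanishes only at `λ = 1`, so the Gram matrix is the identity.
  have hlog : ∑ i, (lam i - 1 - Real.log (lam i)) = 0 := by
    rw [Finset.sum_sub_distrib, ← Real.log_prod (fun i _ => (hpos i).ne'), hprod]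
    simp [hsum]
  have hone : ∀ i, lam i = 1 := fun i => by
    by_contra h
    have h1 := (Finset.sum_eq_zero_iff_of_nonneg fun i _ => by
      have := Real.log_le_sub_one_of_pos (hpos i); linarith).1 hlog i (Finset.mem_univ i)
    have := Real.log_lt_sub_one_of_pos (hpos i) h
    linarith
  have hG : A.transpose * A = 1 := by
    rw [hpsd.isHermitian.spectral_theorem]
    have : (RCLike.ofReal ∘ hpsd.isHermitian.eigenvalues : Fin k → ℝ) = 1 := by
      funext i; simpa using hone i
    rw [this]
    simp
  rw [orthonormal_iff_ite]
  intro i j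
  rw [← hentry, hG, Matrix.one_apply]

/-- A smooth function on `[a,b]` multiplied by a cutoff supported in `(a,b)` is smooth on `ℝ`. -/
theorem contDiff_smul_of_tsupport_subset {F : Type*} [NormedAddCommGroup F] [NormedSpace ℝ F]
    {a b : ℝ} {f : ℝ → F} (hf : ContDiffOn ℝ ∞ f (Icc a b)) {g : ℝ → ℝ} (hg : ContDiff ℝ ∞ g)
    (hsupp : tsupport g ⊆ Ioo a b) : ContDiff ℝ ∞ fun x => g x • f x := by
  rw [contDiff_iff_contDiffAt]
  intro x
  by_cases hx : x ∈ tsupport g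
  · exact hg.contDiffAt.smul (hf.contDiffAt (Icc_mem_nhds (hsupp hx).1 (hsupp hx).2))
  · refine (contDiffAt_const (c := (0 : F))).congr_of_eventuallyEq ?_
    filter_upwards [(notMem_tsupport_iff_eventuallyEq.1 hx)] with y hy
    simp [hy]

/-! ### Calculus on the closed parameter rectangle. -/

section Rectangle

variable {F : Type*} [NormedAddCommGroup F] [NormedSpace ℝ F] {ε a b : ℝ} {f : ℝ × ℝ → F}

theorem uniqueDiffOn_rect (hε : 0 < ε) (hab : a < b) :
    UniqueDiffOn ℝ (Icc (-ε) ε ×ˢ Icc a b) :=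
  (uniqueDiffOn_Icc (by linarith)).prod (uniqueDiffOn_Icc hab)

theorem hasDerivWithinAt_snd_of_rect (hf : ContDiffOn ℝ ∞ f (Icc (-ε) ε ×ˢ Icc a b)) {t x : ℝ}
    (ht : t ∈ Icc (-ε) ε) (hx : x ∈ Icc a b) :
    HasDerivWithinAt (fun y => f (t, y)) (fderivWithin ℝ f (Icc (-ε) ε ×ˢ Icc a b) (t, x) (0, 1))
      (Icc a b) x := by
  have h := (hf.differentiableOn (by simp) (t, x) ⟨ht, hx⟩).hasFDerivWithinAt
  exact h.comp_hasDerivWithinAt (f := fun y => (t, y)) x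
    ((hasDerivWithinAt_const x _ t).prodMk (hasDerivWithinAt_id x _)) fun y hy => ⟨ht, hy⟩

theorem hasDerivAt_fst_of_rect (hf : ContDiffOn ℝ ∞ f (Icc (-ε) ε ×ˢ Icc a b)) {t x : ℝ}
    (ht : t ∈ Ioo (-ε) ε) (hx : x ∈ Icc a b) :
    HasDerivAt (fun s => f (s, x)) (fderivWithin ℝ f (Icc (-ε) ε ×ˢ Icc a b) (t, x) (1, 0)) t := by
  have h := (hf.differentiableOn (by simp) (t, x) ⟨Ioo_subset_Icc_self ht, hx⟩).hasFDerivWithinAt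
  have h' := h.comp_hasDerivWithinAt (f := fun s => (s, x)) (s := Icc (-ε) ε) t
    ((hasDerivWithinAt_id t _).prodMk (hasDerivWithinAt_const t _ x)) fun y hy => ⟨hy, hx⟩
  exact h'.hasDerivAt (Icc_mem_nhds ht.1 ht.2)

theorem contDiffOn_fderivWithin_rect_apply (hε : 0 < ε) (hab : a < b)
    (hf : ContDiffOn ℝ ∞ f (Icc (-ε) ε ×ˢ Icc a b)) (v : ℝ × ℝ) :
    ContDiffOn ℝ ∞ (fun p => fderivWithin ℝ f (Icc (-ε) ε ×ˢ Icc a b) p v)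
      (Icc (-ε) ε ×ˢ Icc a b) :=
  (hf.fderivWithin (uniqueDiffOn_rect hε hab) (by simp)).clm_apply contDiffOn_const

/-- Symmetry of second derivatives extends to the boundary because the rectangle is the closure of
its interior. It serves to exchange `∂ₜ` and `∂ₓ` on the tangent field. -/
theorem fderivWithin_rect_comm (hε : 0 < ε) (hab : a < b)
    (hf : ContDiffOn ℝ ∞ f (Icc (-ε) ε ×ˢ Icc a b)) {p : ℝ × ℝ}
    (hp : p ∈ Icc (-ε) ε ×ˢ Icc a b) (u v : ℝ × ℝ) :
    fderivWithin ℝ (fun q => fderivWithin ℝ f (Icc (-ε) ε ×ˢ Icc a b) q u)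
        (Icc (-ε) ε ×ˢ Icc a b) p v =
      fderivWithin ℝ (fun q => fderivWithin ℝ f (Icc (-ε) ε ×ˢ Icc a b) q v)
        (Icc (-ε) ε ×ˢ Icc a b) p u := by
  set R := Icc (-ε) ε ×ˢ Icc a b with hR
  have hun : UniqueDiffOn ℝ R := uniqueDiffOn_rect hε hab
  have hd : DifferentiableWithinAt ℝ (fderivWithin ℝ f R) R p :=
    ((hf.fderivWithin hun (m := ∞) (by simp)).differentiableOn (by simp)) p hp
  have happ : ∀ z w : ℝ × ℝ, fderivWithin ℝ (fun q => fderivWithin ℝ f R q z) R p w =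
      fderivWithin ℝ (fderivWithin ℝ f R) R p w z := fun z w => by
    rw [fderivWithin_clm_apply (hun p hp) hd (differentiableWithinAt_const z)]
    simp
  rw [happ, happ]
  have hcl : p ∈ closure (interior R) := by
    rw [hR, interior_prod_eq, closure_prod_eq, interior_Icc, interior_Icc,
      closure_Ioo (by linarith), closure_Ioo hab.ne]
    exact hp
  exact (ContDiffWithinAt.isSymmSndFDerivWithinAt (hf p hp)
    (by rw [minSmoothness_of_isRCLikeNormedField]; exact WithTop.coe_le_coe.2 (le_top : (2 : ℕ∞) ≤ ⊤)) hun hcl hp).eq v u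

theorem hasDerivAt_intervalIntegral_rect (hε : 0 < ε) (hab : a < b)
    (hf : ContDiffOn ℝ ∞ f (Icc (-ε) ε ×ˢ Icc a b)) :
    HasDerivAt (fun t => ∫ x in a..b, f (t, x))
      (∫ x in a..b, fderivWithin ℝ f (Icc (-ε) ε ×ˢ Icc a b) (0, x) (1, 0)) 0 := by
  have hf' := contDiffOn_fderivWithin_rect_apply hε hab hf (1, 0)
  obtain ⟨C, hC⟩ := (isCompact_Icc.prod isCompact_Icc).exists_bound_of_continuousOn hf'.continuousOn
  have hslice : ∀ {g : ℝ × ℝ → F}, ContinuousOn g (Icc (-ε) ε ×ˢ Icc a b) → ∀ t ∈ Icc (-ε) ε,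
      IntervalIntegrable (fun x => g (t, x)) volume a b := fun {g} hg t ht => by
    refine ContinuousOn.intervalIntegrable ?_
    rw [uIcc_of_le hab.le]
    exact hg.comp (Continuous.prodMk_right t).continuousOn fun x hx => ⟨ht, hx⟩
  have h0 : (0 : ℝ) ∈ Icc (-ε) ε := ⟨by linarith, hε.le⟩
  have hsub : uIoc a b ⊆ Icc a b := by
    rw [uIoc_of_le hab.le]; exact Ioc_subset_Icc_self
  refine (intervalIntegral.hasDerivAt_integral_of_dominated_loc_of_deriv_le
    (F' := fun t x => fderivWithin ℝ f (Icc (-ε) ε ×ˢ Icc a b) (t, x) (1, 0))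
    (bound := fun _ => C) (s := Ioo (-ε) ε) (Ioo_mem_nhds (by linarith) hε) ?_ ?_ ?_ ?_ ?_ ?_).2
  · filter_upwards [Icc_mem_nhds (neg_lt_zero.2 hε) hε] with t ht
    exact (hslice hf.continuousOn t ht).def'.aestronglyMeasurable
  · exact hslice hf.continuousOn 0 h0
  · exact (hslice hf'.continuousOn 0 h0).def'.aestronglyMeasurable
  · exact Eventually.of_forall fun x hx t ht => hC (t, x) ⟨Ioo_subset_Icc_self ht, hsub hx⟩
  · exact intervalIntegrable_const
  · exact Eventually.of_forall fun x hx t ht => hasDerivAt_fst_of_rect hf ht (hsub hx)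

end Rectangle

/-! ### Calculus on `[a,b]` and the first variation formula. -/

namespace ElasticCurve

section Calculus

variable {F : Type*} [NormedAddCommGroup F] [NormedSpace ℝ F] {a b : ℝ}

theorem D_congr {f g : ℝ → F} (h : ∀ x ∈ Icc a b, f x = g x) {x : ℝ} (hx : x ∈ Icc a b) :
    D a b f x = D a b g x :=
  derivWithin_congr h (h x hx)

theorem D_eq (hab : a < b) {f : ℝ → F} {f' : F} {x : ℝ} (hx : x ∈ Icc a b)
    (h : HasDerivWithinAt f f' (Icc a b) x) : D a b f x = f' :=
  h.derivWithin (uniqueDiffOn_Icc hab x hx)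

theorem SmoothOn.hasDerivWithinAt {f : ℝ → F} (hf : SmoothOn a b f) {x : ℝ} (hx : x ∈ Icc a b) :
    HasDerivWithinAt f (D a b f x) (Icc a b) x :=
  (hf.differentiableOn (by simp) x hx).hasDerivWithinAt

theorem SmoothOn.D (hab : a < b) {f : ℝ → F} (hf : SmoothOn a b f) : SmoothOn a b (D a b f) :=
  hf.derivWithin (uniqueDiffOn_Icc hab) (by simp)

theorem SmoothOn.intervalIntegrable (hab : a < b) {f : ℝ → F} (hf : SmoothOn a b f) :
    IntervalIntegrable f volume a b :=
  ContinuousOn.intervalIntegrable (by rw [uIcc_of_le hab.le]; exact hf.continuousOn)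

theorem SmoothOn.integral_D [CompleteSpace F] (hab : a < b) {f : ℝ → F} (hf : SmoothOn a b f) :
    ∫ x in a..b, ElasticCurve.D a b f x = f b - f a :=
  intervalIntegral.integral_eq_sub_of_hasDerivAt_of_le hab.le hf.continuousOn
    (fun _ hx => (hf.hasDerivWithinAt (Ioo_subset_Icc_self hx)).hasDerivAt
      (Icc_mem_nhds hx.1 hx.2)) ((hf.D hab).intervalIntegrable hab)

theorem SmoothOn.eq_of_D_eq_zero {f : ℝ → F} (hf : SmoothOn a b f)
    (h : ∀ x ∈ Icc a b, ElasticCurve.D a b f x = 0) : ∀ x ∈ Icc a b, f x = f a :=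
  constant_of_derivWithin_zero (hf.differentiableOn (by simp))
    fun x hx => h x (Ico_subset_Icc_self hx)

/-- Integration by parts against a field vanishing at the end points. -/
theorem integral_inner_D {E : Type*} [NormedAddCommGroup E] [InnerProductSpace ℝ E] (hab : a < b)
    {f w : ℝ → E} (hf : SmoothOn a b f) (hw : SmoothOn a b w) (ha : w a = 0) (hb : w b = 0) :
    ∫ x in a..b, inner ℝ (f x) (D a b w x) = -∫ x in a..b, inner ℝ (D a b f x) (w x) := by
  have h : SmoothOn a b fun x => inner ℝ (f x) (w x) := hf.inner ℝ hw
  have h1 := h.integral_D hab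
  have h2 : ∀ x ∈ Icc a b, D a b (fun x => (inner ℝ (f x) (w x) : ℝ)) x =
      inner ℝ (f x) (D a b w x) + inner ℝ (D a b f x) (w x) := fun x hx =>
    D_eq hab hx ((hf.hasDerivWithinAt hx).inner ℝ (hw.hasDerivWithinAt hx))
  rw [intervalIntegral.integral_congr (g := fun x => (inner ℝ (f x) (D a b w x) : ℝ) +
      inner ℝ (D a b f x) (w x)) (by rw [uIcc_of_le hab.le]; exact h2),
    intervalIntegral.integral_add
      (SmoothOn.intervalIntegrable hab (hf.inner ℝ (hw.D hab)))
      (SmoothOn.intervalIntegrable hab ((hf.D hab).inner ℝ hw)), ha, hb] at h1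
  simp only [inner_zero_right, sub_self] at h1
  linarith

end Calculus

variable {n : ℕ} {a b : ℝ} {γ : ℝ → EuclideanSpace ℝ (Fin n)} {ϱ : ℝ → ℝ}

theorem IsArcLengthCurve.arcDeriv_eq {F : Type*} [NormedAddCommGroup F] [NormedSpace ℝ F]
    (hγ : IsArcLengthCurve a b γ) (g : ℝ → F) {x : ℝ} (hx : x ∈ Icc a b) :
    arcDeriv a b γ g x = D a b g x := by
  rw [arcDeriv, hγ.2 x hx, inv_one, one_smul]

theorem IsArcLengthCurve.tangent_eq (hγ : IsArcLengthCurve a b γ) {x : ℝ} (hx : x ∈ Icc a b) :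
    tangent a b γ x = D a b γ x :=
  hγ.arcDeriv_eq γ hx

theorem IsArcLengthCurve.bendingEnergy_eq (hab : a < b) (hγ : IsArcLengthCurve a b γ) :
    bendingEnergy a b ϱ γ = (1 / 2) * ∫ x in a..b,
      ϱ x * inner ℝ (D a b (D a b γ) x) (D a b (D a b γ) x) := by
  rw [bendingEnergy]
  congr 1
  refine intervalIntegral.integral_congr fun x hx => ?_
  rw [uIcc_of_le hab.le] at hx
  rw [hγ.arcDeriv_eq _ hx, hγ.2 x hx, mul_one, D_congr (fun y hy => hγ.tangent_eq hy) hx]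

/-- The first variation of the bending energy through arc-length parametrized curves, expressed in
the variation `w` of the unit tangent. -/
theorem exists_firstVariation (hab : a < b) (hϱ : SmoothOn a b ϱ)
    {ε : ℝ} {Γ : ℝ → ℝ → EuclideanSpace ℝ (Fin n)} (hV : IsVariation a b γ ε Γ)
    (hΓ : ∀ t ∈ Icc (-ε) ε, IsArcLengthCurve a b (Γ t)) :
    ∃ w : ℝ → EuclideanSpace ℝ (Fin n), SmoothOn a b w ∧
      (∀ x ∈ Icc a b, HasDerivAt (fun t => D a b (Γ t) x) (w x) 0) ∧
      (∀ x ∈ Icc a b, inner ℝ (w x) (D a b γ x) = 0) ∧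
      ∫ x in a..b, w x = 0 ∧
      HasDerivAt (fun t => bendingEnergy a b ϱ (Γ t))
        (-∫ x in a..b, inner ℝ (D a b (fun y => ϱ y • D a b (D a b γ) y) x) (w x)) 0 := by
  have hε := hV.pos
  have hI0 : (0 : ℝ) ∈ Ioo (-ε) ε := ⟨by linarith, hε⟩
  have hI0' := Ioo_subset_Icc_self hI0
  have hnhds : Icc (-ε) ε ∈ 𝓝 (0 : ℝ) := Icc_mem_nhds hI0.1 hI0.2
  set R := Icc (-ε) ε ×ˢ Icc a b with hR
  set f : ℝ × ℝ → EuclideanSpace ℝ (Fin n) := fun p => Γ p.1 p.2 with hfdef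
  have hf : ContDiffOn ℝ ∞ f R := hV.smooth
  -- On the rectangle `u` is the tangent, `v` its `x`-derivative and `ut` its `t`-derivative; the
  -- required field is `w = ut (0, ·)`.
  set u : ℝ × ℝ → EuclideanSpace ℝ (Fin n) := fun p => fderivWithin ℝ f R p (0, 1) with hudef
  have hu : ContDiffOn ℝ ∞ u R := contDiffOn_fderivWithin_rect_apply hε hab hf _
  set v : ℝ × ℝ → EuclideanSpace ℝ (Fin n) := fun p => fderivWithin ℝ u R p (0, 1) with hvdef
  have hv : ContDiffOn ℝ ∞ v R := contDiffOn_fderivWithin_rect_apply hε hab hu _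
  set ut : ℝ × ℝ → EuclideanSpace ℝ (Fin n) := fun p => fderivWithin ℝ u R p (1, 0) with hutdef
  have hut : ContDiffOn ℝ ∞ ut R := contDiffOn_fderivWithin_rect_apply hε hab hu _
  have hslice : ∀ {g : ℝ × ℝ → EuclideanSpace ℝ (Fin n)}, ContDiffOn ℝ ∞ g R →
      SmoothOn a b fun x => g (0, x) := fun {g} hg =>
    ContDiffOn.comp hg (f := fun x : ℝ => ((0 : ℝ), x)) (by fun_prop) fun x hx => ⟨hI0', hx⟩
  have hDu : ∀ t ∈ Icc (-ε) ε, ∀ x ∈ Icc a b, D a b (Γ t) x = u (t, x) := fun t ht x hx =>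
    D_eq hab hx (hasDerivWithinAt_snd_of_rect hf ht hx)
  have hDv : ∀ t ∈ Icc (-ε) ε, ∀ x ∈ Icc a b, D a b (D a b (Γ t)) x = v (t, x) :=
    fun t ht x hx => by
      rw [D_congr (hDu t ht) hx]
      exact D_eq hab hx (hasDerivWithinAt_snd_of_rect hu ht hx)
  have hDγ : ∀ x ∈ Icc a b, D a b γ x = u (0, x) := fun x hx => by
    rw [← hDu 0 hI0' x hx, D_congr hV.zero hx]
  have hDDγ : ∀ x ∈ Icc a b, D a b (D a b γ) x = v (0, x) := fun x hx => by
    rw [D_congr hDγ hx]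
    exact D_eq hab hx (hasDerivWithinAt_snd_of_rect hu hI0' hx)
  have hw : SmoothOn a b fun x => ut (0, x) := hslice hut
  have huw : ∀ x ∈ Icc a b, HasDerivAt (fun t => u (t, x)) (ut (0, x)) 0 := fun x hx =>
    hasDerivAt_fst_of_rect hu hI0 hx
  have hderiv : ∀ x ∈ Icc a b, HasDerivAt (fun t => D a b (Γ t) x) (ut (0, x)) 0 := fun x hx =>
    (huw x hx).congr_of_eventuallyEq (by filter_upwards [hnhds] with t ht using hDu t ht x hx)
  have hDw : ∀ x ∈ Icc a b, D a b (fun y => ut (0, y)) x = fderivWithin ℝ v R (0, x) (1, 0) :=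
    fun x hx => by
      rw [D_eq hab hx (hasDerivWithinAt_snd_of_rect hut hI0' hx)]
      exact fderivWithin_rect_comm hε hab hu ⟨hI0', hx⟩ _ _
  obtain ⟨δ, hδ, hsupp⟩ := hV.compact_support
  -- Near the ends `Γ t` agrees with `γ`, so its tangent there does not depend on `t`. This removes
  -- the boundary terms below.
  have hends : ∀ x ∈ Icc a b, (∀ᶠ y in 𝓝[Icc a b] x, y ≤ a + δ ∨ b - δ ≤ y) → ut (0, x) = 0 := by
    intro x hx hev
    refine (hderiv x hx).unique ((hasDerivAt_const (0 : ℝ) (D a b γ x)).congr_of_eventuallyEq ?_)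
    filter_upwards [hnhds] with t ht
    refine Filter.EventuallyEq.derivWithin_eq ?_ (hsupp t ht x hx (hev.self_of_nhdsWithin hx))
    filter_upwards [hev, self_mem_nhdsWithin] with y hy hy' using hsupp t ht y hy' hy
  have hwa : ut (0, a) = 0 := hends a (left_mem_Icc.2 hab.le) <|
    mem_nhdsWithin_of_mem_nhds <| by
      filter_upwards [Iio_mem_nhds (show a < a + δ by linarith)] with y hy using Or.inl (le_of_lt hy)
  have hwb : ut (0, b) = 0 := hends b (right_mem_Icc.2 hab.le) <|
    mem_nhdsWithin_of_mem_nhds <| by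
      filter_upwards [Ioi_mem_nhds (show b - δ < b by linarith)] with y hy using Or.inr (le_of_lt hy)
  refine ⟨fun x => ut (0, x), hw, hderiv, fun x hx => ?_, ?_, ?_⟩
  · have h1 := (huw x hx).inner ℝ (huw x hx)
    have h2 := h1.unique ((hasDerivAt_const (0 : ℝ) (1 : ℝ)).congr_of_eventuallyEq (by
      filter_upwards [hnhds] with t ht
      rw [← hDu t ht x hx, real_inner_self_eq_norm_sq, (hΓ t ht).2 x hx, one_pow]))
    rw [hDγ x hx]
    rw [real_inner_comm (ut (0, x)) (u (0, x))] at h2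
    linarith
  -- The integral of the tangent is `Γ t b - Γ t a`, which is constant in `t`.
  · refine (hasDerivAt_intervalIntegral_rect hε hab hu).unique
      ((hasDerivAt_const (0 : ℝ) (γ b - γ a)).congr_of_eventuallyEq ?_)
    filter_upwards [hnhds] with t ht
    rw [← hsupp t ht b (right_mem_Icc.2 hab.le) (Or.inr (by linarith)),
      ← hsupp t ht a (left_mem_Icc.2 hab.le) (Or.inl (by linarith)), ← (hΓ t ht).1.integral_D hab]
    refine intervalIntegral.integral_congr fun x hx => ?_
    rw [uIcc_of_le hab.le] at hx
    exact (hDu t ht x hx).symm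
  · set e : ℝ × ℝ → ℝ := fun p => ϱ p.2 * inner ℝ (v p) (v p) with hedef
    have he : ContDiffOn ℝ ∞ e R :=
      (ContDiffOn.comp hϱ contDiffOn_snd fun p hp => hp.2).mul (hv.inner ℝ hv)
    have hE : (fun t => bendingEnergy a b ϱ (Γ t)) =ᶠ[𝓝 0]
        fun t => (1 / 2) * ∫ x in a..b, e (t, x) := by
      filter_upwards [hnhds] with t ht
      rw [(hΓ t ht).bendingEnergy_eq hab]
      congr 1
      refine intervalIntegral.integral_congr fun x hx => ?_
      rw [uIcc_of_le hab.le] at hx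
      simp only [hedef]
      rw [hDv t ht x hx]
    have hd := ((hasDerivAt_intervalIntegral_rect hε hab he).const_mul (1 / 2)).congr_of_eventuallyEq
      hE
    have hG : SmoothOn a b fun y => ϱ y • v (0, y) := ContDiffOn.smul hϱ (hslice hv)
    have hGD : ∀ x ∈ Icc a b, D a b (fun y => ϱ y • D a b (D a b γ) y) x =
        D a b (fun y => ϱ y • v (0, y)) x := fun x hx =>
      D_congr (fun y hy => by rw [hDDγ y hy]) hx
    refine HasDerivAt.congr_deriv hd (Eq.symm ?_)
    rw [intervalIntegral.integral_congr
      (g := fun x => (inner ℝ (D a b (fun y => ϱ y • v (0, y)) x) (ut (0, x)) : ℝ))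
      (fun x hx => by
        rw [uIcc_of_le hab.le] at hx
        simp only [hGD x hx]), ← integral_inner_D hab hG hw hwa hwb,
      ← intervalIntegral.integral_const_mul]
    refine intervalIntegral.integral_congr fun x hx => ?_
    rw [uIcc_of_le hab.le] at hx
    have hvt := hasDerivAt_fst_of_rect hv hI0 hx
    rw [(hasDerivAt_fst_of_rect he hI0 hx).unique ((hvt.inner ℝ hvt).const_mul (ϱ x)), hDw x hx,
      real_inner_smul_left, real_inner_comm (v (0, x)) (fderivWithin ℝ v R (0, x) (1, 0))]
    ring

end ElasticCurve

/-! ### The parallel frame, and multipliers as constant vectors. -/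

namespace ElasticCurve

variable {m : ℕ} {a b : ℝ} {γ : ℝ → EuclideanSpace ℝ (Fin (m + 1))} {ϱ : ℝ → ℝ}
  {N : Fin m → ℝ → EuclideanSpace ℝ (Fin (m + 1))} {κ : ℝ → EuclideanSpace ℝ (Fin m)}

theorem SmoothOn.apply {k : ℕ} {f : ℝ → EuclideanSpace ℝ (Fin k)} (hf : SmoothOn a b f)
    (i : Fin k) : SmoothOn a b fun x => f x i :=
  contDiffOn_euclidean.1 hf i

theorem SmoothOn.D_apply {k : ℕ} (hab : a < b) {f : ℝ → EuclideanSpace ℝ (Fin k)}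
    (hf : SmoothOn a b f) (i : Fin k) {x : ℝ} (hx : x ∈ Icc a b) :
    ElasticCurve.D a b (fun y => f y i) x = ElasticCurve.D a b f x i :=
  D_eq hab hx <| (EuclideanSpace.proj (𝕜 := ℝ) i).hasFDerivAt.comp_hasDerivWithinAt x
    (hf.hasDerivWithinAt hx)

theorem IsParallelFrame.orthonormal (hγ : IsArcLengthCurve a b γ) (hN : IsParallelFrame a b γ N)
    {x : ℝ} (hx : x ∈ Icc a b) :
    Orthonormal ℝ (Fin.cons (D a b γ x) (fun k => N k x) :
      Fin (m + 1) → EuclideanSpace ℝ (Fin (m + 1))) := by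
  rw [← hγ.tangent_eq hx]
  refine orthonormal_of_det_eq_one _ (fun i => ?_) (hN.det_eq_one x hx)
  refine Fin.cases ?_ (fun j => ?_) i
  · rw [Fin.cons_zero, hγ.tangent_eq hx, hγ.2 x hx]
  · rw [Fin.cons_succ, hN.unit j x hx]

theorem IsParallelFrame.inner_normal (hγ : IsArcLengthCurve a b γ) (hN : IsParallelFrame a b γ N)
    {x : ℝ} (hx : x ∈ Icc a b) (i j : Fin m) :
    inner ℝ (N i x) (N j x) = if i = j then (1 : ℝ) else 0 := by
  have h := orthonormal_iff_ite.1 (hN.orthonormal hγ hx) i.succ j.succ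
  simpa using h

theorem IsParallelFrame.inner_tangent (hγ : IsArcLengthCurve a b γ) (hN : IsParallelFrame a b γ N)
    {x : ℝ} (hx : x ∈ Icc a b) (i : Fin m) : inner ℝ (N i x) (D a b γ x) = 0 := by
  rw [← hγ.tangent_eq hx]
  exact (hN.parallel i).2.1 x hx

theorem IsArcLengthCurve.inner_self (hγ : IsArcLengthCurve a b γ) {x : ℝ} (hx : x ∈ Icc a b) :
    inner ℝ (D a b γ x) (D a b γ x) = (1 : ℝ) := by
  rw [real_inner_self_eq_norm_sq, hγ.2 x hx, one_pow]

theorem IsCurvatureFunction.D_tangent (hγ : IsArcLengthCurve a b γ)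
    (hκ : IsCurvatureFunction a b γ N κ) {x : ℝ} (hx : x ∈ Icc a b) :
    D a b (D a b γ) x = -∑ i, κ x i • N i x := by
  rw [← hκ.2 x hx]
  exact D_congr (fun y hy => (hγ.tangent_eq hy).symm) hx

/-- Along a parallel frame `Nᵢ' = κᵢ T`. -/
theorem IsParallelFrame.D_normal (hab : a < b) (hγ : IsArcLengthCurve a b γ)
    (hN : IsParallelFrame a b γ N) (hκ : IsCurvatureFunction a b γ N κ) {x : ℝ}
    (hx : x ∈ Icc a b) (i : Fin m) : D a b (N i) x = κ x i • D a b γ x := by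
  obtain ⟨hNs, -, lam, -, hlam⟩ := hN.parallel i
  have h1 := hlam x hx
  rw [hγ.tangent_eq hx] at h1
  -- Differentiating `⟨Nᵢ, T⟩ = 0` gives `lam - κᵢ = 0`.
  have h2 : D a b (fun y => (inner ℝ (N i y) (D a b γ y) : ℝ)) x = _ :=
    D_eq hab hx ((hNs.hasDerivWithinAt hx).inner ℝ ((hγ.1.D hab).hasDerivWithinAt hx))
  rw [D_congr (g := fun _ => (0 : ℝ)) (fun y hy => hN.inner_tangent hγ hy i) hx,
    D_eq hab hx (hasDerivWithinAt_const x _ (0 : ℝ)), h1, hκ.D_tangent hγ hx,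
    real_inner_smul_left, hγ.inner_self hx, inner_neg_right, inner_sum] at h2
  simp only [real_inner_smul_right, hN.inner_normal hγ hx, mul_ite, mul_one, mul_zero,
    Finset.sum_ite_eq, Finset.mem_univ, if_true] at h2
  rw [h1, show lam x = κ x i by linarith]

/-- The decomposition of `(ϱT')'` in the parallel frame. -/
theorem D_smul_D_tangent (hab : a < b) (hγ : IsArcLengthCurve a b γ) (hϱ : SmoothOn a b ϱ)
    (hN : IsParallelFrame a b γ N) (hκ : IsCurvatureFunction a b γ N κ) {x : ℝ}
    (hx : x ∈ Icc a b) :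
    D a b (fun y => ϱ y • D a b (D a b γ) y) x =
      -∑ i, (D a b (fun y => ϱ y • κ y) x i • N i x + (ϱ x * (κ x i * κ x i)) • D a b γ x) := by
  have hp : SmoothOn a b fun y => ϱ y • κ y := ContDiffOn.smul hϱ hκ.1
  rw [D_congr (g := fun y => -∑ i, (ϱ y • κ y) i • N i y) (fun y hy => by
    rw [hκ.D_tangent hγ hy, smul_neg, Finset.smul_sum]
    simp [smul_smul]) hx]
  refine D_eq hab hx (HasDerivWithinAt.neg (HasDerivWithinAt.fun_sum fun i _ => ?_))
  have h := ((hp.apply i).hasDerivWithinAt hx).smul ((hN.parallel i).1.hasDerivWithinAt hx)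
  refine h.congr_deriv ?_
  rw [hN.D_normal hab hγ hκ hx, hp.D_apply hab i hx]
  simp only [PiLp.smul_apply, smul_eq_mul, smul_smul, mul_assoc]
  exact add_comm _ _

/-- The Euler-Lagrange equations `(ϱκ)'' + ½ϱ⟨κ,κ⟩κ - Λκ = 0`, `Λ' + ½ϱ'⟨κ,κ⟩ = 0`
with a smooth multiplier `Λ`. -/
def HasMultiplier (a b : ℝ) (ϱ : ℝ → ℝ) (κ : ℝ → EuclideanSpace ℝ (Fin m)) : Prop :=
  ∃ Λ : ℝ → ℝ, SmoothOn a b Λ ∧ ∀ x ∈ Set.Icc a b,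
    D a b (D a b (fun y => ϱ y • κ y)) x
        + ((1 / 2) * ϱ x * inner ℝ (κ x) (κ x)) • κ x - Λ x • κ x = 0 ∧
      D a b Λ x + (1 / 2) * D a b ϱ x * inner ℝ (κ x) (κ x) = 0

theorem D_smul_curvature (hab : a < b) (hϱ : SmoothOn a b ϱ) (hκ : SmoothOn a b κ) {x : ℝ}
    (hx : x ∈ Icc a b) :
    D a b (fun y => ϱ y • κ y) x = ϱ x • D a b κ x + D a b ϱ x • κ x :=
  D_eq hab hx ((hϱ.hasDerivWithinAt hx).smul (hκ.hasDerivWithinAt hx))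

theorem hasDerivWithinAt_half_mul_inner_self (hϱ : SmoothOn a b ϱ) (hκ : SmoothOn a b κ) {x : ℝ}
    (hx : x ∈ Icc a b) :
    HasDerivWithinAt (fun y => (1 / 2) * (ϱ y * inner ℝ (κ y) (κ y)))
      ((1 / 2) * D a b ϱ x * inner ℝ (κ x) (κ x) + ϱ x * inner ℝ (D a b κ x) (κ x))
      (Icc a b) x := by
  refine (((hϱ.hasDerivWithinAt hx).mul ((hκ.hasDerivWithinAt hx).inner ℝ
    (hκ.hasDerivWithinAt hx))).const_mul (1 / 2)).congr_deriv ?_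
  rw [real_inner_comm (D a b κ x) (κ x)]
  ring

theorem sum_apply_mul {k : ℕ} (y z : EuclideanSpace ℝ (Fin k)) :
    ∑ i, y i * z i = inner ℝ y z := by
  simp [PiLp.inner_apply, mul_comm]

/-- A multiplier gives a constant vector whose normal part is that of `(ϱT')'`. -/
theorem HasMultiplier.exists_const (hab : a < b) (hγ : IsArcLengthCurve a b γ)
    (hϱ : SmoothOn a b ϱ) (hN : IsParallelFrame a b γ N) (hκ : IsCurvatureFunction a b γ N κ)
    (h : HasMultiplier a b ϱ κ) :
    ∃ c : EuclideanSpace ℝ (Fin (m + 1)), ∀ x ∈ Icc a b,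
      ∃ r : ℝ, D a b (fun y => ϱ y • D a b (D a b γ) y) x = c + r • D a b γ x := by
  obtain ⟨Λ, hΛ, heq⟩ := h
  have hp : SmoothOn a b fun y => ϱ y • κ y := ContDiffOn.smul hϱ hκ.1
  have hq := hp.D hab
  set q := D a b fun y => ϱ y • κ y with hqdef
  -- In `c'` the coefficient of `Nᵢ` is `-((ϱκ)''ᵢ + μκᵢ)` and that of `T` is `μ' - ⟨(ϱκ)', κ⟩ =
  -- -(Λ' + ½ϱ'|κ|²)`; both vanish by hypothesis.
  set μ : ℝ → ℝ := fun y => (1 / 2) * (ϱ y * inner ℝ (κ y) (κ y)) - Λ y with hμ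
  set c : ℝ → EuclideanSpace ℝ (Fin (m + 1)) :=
    fun y => μ y • D a b γ y - ∑ i, q y i • N i y with hc
  have hμs : SmoothOn a b μ :=
    ContDiffOn.sub (contDiffOn_const.mul (ContDiffOn.mul hϱ (ContDiffOn.inner ℝ hκ.1 hκ.1))) hΛ
  have hcs : SmoothOn a b c := by
    refine ContDiffOn.sub (ContDiffOn.smul hμs (hγ.1.D hab)) (ContDiffOn.sum fun i _ => ?_)
    exact ContDiffOn.smul (hq.apply i) (hN.parallel i).1
  have hDc : ∀ x ∈ Icc a b, D a b c x = 0 := by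
    intro x hx
    have hμd := (hasDerivWithinAt_half_mul_inner_self hϱ hκ.1 hx).sub (hΛ.hasDerivWithinAt hx)
    have h1 : HasDerivWithinAt c (μ x • D a b (D a b γ) x +
        ((1 / 2) * D a b ϱ x * inner ℝ (κ x) (κ x) + ϱ x * inner ℝ (D a b κ x) (κ x)
          - D a b Λ x) • D a b γ x -
        ∑ i, (q x i • D a b (N i) x + D a b (fun y => q y i) x • N i x)) (Icc a b) x :=
      (hμd.smul ((hγ.1.D hab).hasDerivWithinAt hx)).sub
      (HasDerivWithinAt.fun_sum (u := Finset.univ) fun i _ =>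
        ((hq.apply i).hasDerivWithinAt hx).smul ((hN.parallel i).1.hasDerivWithinAt hx))
    rw [D_eq hab hx h1]
    obtain ⟨e1, e2⟩ := heq x hx
    have e1' : ∀ i, D a b q x i = -(μ x * κ x i) := fun i => by
      have := congrArg (fun z : EuclideanSpace ℝ (Fin m) => z i) e1
      simp only [PiLp.add_apply, PiLp.sub_apply, PiLp.smul_apply, smul_eq_mul,
        PiLp.zero_apply] at this
      simp only [hμ]
      linarith
    have e3 : (1 / 2) * D a b ϱ x * inner ℝ (κ x) (κ x) + ϱ x * inner ℝ (D a b κ x) (κ x)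
        - D a b Λ x = ∑ i, q x i * κ x i := by
      rw [sum_apply_mul, hqdef, D_smul_curvature hab hϱ hκ.1 hx, inner_add_left,
        real_inner_smul_left, real_inner_smul_left]
      linarith
    rw [e3, hκ.D_tangent hγ hx, smul_neg, Finset.smul_sum, Finset.sum_smul]
    simp only [hN.D_normal hab hγ hκ hx, hq.D_apply hab _ hx, e1', smul_smul, Finset.sum_add_distrib,
      neg_smul, Finset.sum_neg_distrib, hμ]
    abel
  refine ⟨c a, fun x hx => ⟨-(∑ i, ϱ x * (κ x i * κ x i)) - μ x, ?_⟩⟩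
  rw [← hcs.eq_of_D_eq_zero hDc x hx, D_smul_D_tangent hab hγ hϱ hN hκ hx]
  simp only [hc, Finset.sum_add_distrib, sub_smul, neg_smul, Finset.sum_smul]
  abel

/-- A constant vector whose normal part is that of `(ϱT')'` gives a multiplier. -/
theorem hasMultiplier_of_const (hab : a < b) (hγ : IsArcLengthCurve a b γ)
    (hϱ : SmoothOn a b ϱ) (hN : IsParallelFrame a b γ N) (hκ : IsCurvatureFunction a b γ N κ)
    (c : EuclideanSpace ℝ (Fin (m + 1)))
    (hc : ∀ x ∈ Icc a b, ∀ i,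
      inner ℝ (D a b (fun y => ϱ y • D a b (D a b γ) y) x - c) (N i x) = 0) :
    HasMultiplier a b ϱ κ := by
  have hp : SmoothOn a b fun y => ϱ y • κ y := ContDiffOn.smul hϱ hκ.1
  have hq := hp.D hab
  set q := D a b fun y => ϱ y • κ y with hqdef
  have hcq : ∀ x ∈ Icc a b, ∀ i, q x i = -inner ℝ c (N i x) := by
    intro x hx i
    have h := hc x hx i
    have ht : inner ℝ (D a b γ x) (N i x) = (0 : ℝ) := by
      rw [real_inner_comm]; exact hN.inner_tangent hγ hx i
    rw [D_smul_D_tangent hab hγ hϱ hN hκ hx, inner_sub_left, inner_neg_left, sum_inner] at h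
    simp only [inner_add_left, real_inner_smul_left, ht, hN.inner_normal hγ hx, mul_ite, mul_one,
      mul_zero, add_zero, Finset.sum_ite_eq', Finset.mem_univ, if_true] at h
    linarith
  have hcT : ∀ x ∈ Icc a b, HasDerivWithinAt (fun y => (inner ℝ c (D a b γ y) : ℝ))
      (∑ i, κ x i * q x i) (Icc a b) x := fun x hx => by
    refine ((hasDerivWithinAt_const x _ c).inner ℝ
      ((hγ.1.D hab).hasDerivWithinAt hx)).congr_deriv ?_
    rw [hκ.D_tangent hγ hx, inner_neg_right, inner_sum, inner_zero_left, add_zero,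
      ← Finset.sum_neg_distrib]
    exact Finset.sum_congr rfl fun i _ => by rw [hcq x hx, real_inner_smul_right]; ring
  -- The tangential component of the constant vector is `μ = ⟨c, T⟩`, which dictates `Λ = ½ϱ|κ|² -
  -- ⟨c, T⟩`.
  refine ⟨fun y => (1 / 2) * (ϱ y * inner ℝ (κ y) (κ y)) - inner ℝ c (D a b γ y), ?_,
    fun x hx => ⟨?_, ?_⟩⟩
  · exact ContDiffOn.sub (contDiffOn_const.mul (ContDiffOn.mul hϱ (ContDiffOn.inner ℝ hκ.1 hκ.1)))
      (contDiffOn_const.inner ℝ (hγ.1.D hab))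
  · ext i
    have h1 : D a b q x i = -(κ x i * inner ℝ c (D a b γ x)) := by
      rw [← hq.D_apply hab i hx, D_congr (fun y hy => hcq y hy i) hx]
      refine D_eq hab hx (((hasDerivWithinAt_const x _ c).inner ℝ
        ((hN.parallel i).1.hasDerivWithinAt hx)).neg.congr_deriv ?_)
      rw [hN.D_normal hab hγ hκ hx, real_inner_smul_right, inner_zero_left, add_zero]
    simp only [PiLp.add_apply, PiLp.sub_apply, PiLp.smul_apply, smul_eq_mul, PiLp.zero_apply,
      ← hqdef, h1]
    ring
  · rw [D_eq hab hx ((hasDerivWithinAt_half_mul_inner_self hϱ hκ.1 hx).fun_sub (hcT x hx))]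
    have : ∑ i, κ x i * q x i = ϱ x * inner ℝ (D a b κ x) (κ x)
        + D a b ϱ x * inner ℝ (κ x) (κ x) := by
      rw [sum_apply_mul, hqdef, D_smul_curvature hab hϱ hκ.1 hx, inner_add_right,
        real_inner_smul_right, real_inner_smul_right, real_inner_comm]
    rw [this]
    ring

/-- Since `w ⊥ T`, only the normal part of `(ϱT')'` matters, and the first variation becomes `-⟨c, ∫
w⟩ = 0`. -/
theorem HasMultiplier.isElastic (hab : a < b) (hγ : IsArcLengthCurve a b γ)
    (hϱ : SmoothOn a b ϱ) (hN : IsParallelFrame a b γ N) (hκ : IsCurvatureFunction a b γ N κ)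
    (h : HasMultiplier a b ϱ κ) : IsElastic a b ϱ γ := by
  intro ε Γ hV hΓ
  obtain ⟨c, hc⟩ := h.exists_const hab hγ hϱ hN hκ
  obtain ⟨w, hw, -, hperp, hint, hd⟩ := exists_firstVariation hab hϱ hV hΓ
  refine hd.congr_deriv ?_
  rw [neg_eq_zero, intervalIntegral.integral_congr (g := fun x => (inner ℝ c (w x) : ℝ)) (by
    intro x hx
    rw [uIcc_of_le hab.le] at hx
    obtain ⟨r, hr⟩ := hc x hx
    simp only [hr]
    rw [inner_add_left, real_inner_smul_left,
      real_inner_comm (w x) (D a b γ x), hperp x hx, mul_zero, add_zero])]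
  have := ((innerSL ℝ) c).intervalIntegral_comp_comm (SmoothOn.intervalIntegrable hab hw)
  simp only [innerSL_apply_apply] at this
  rw [this, hint, inner_zero_right]

end ElasticCurve

/-! ### Construction of arc-length preserving variations. -/

section Perturbation

variable {E : Type*} [NormedAddCommGroup E] [InnerProductSpace ℝ E]

/-- The displacement from the unit vector `S` to the normalization of `S + W`, where `W ⊥ S`. -/
noncomputable def normalizedDisplacement (S W : E) : E :=
  ((√(1 + ‖W‖ ^ 2))⁻¹ - 1) • S + (√(1 + ‖W‖ ^ 2))⁻¹ • W

@[simp]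
theorem normalizedDisplacement_zero (S : E) : normalizedDisplacement S 0 = 0 := by
  simp [normalizedDisplacement]

theorem norm_add_normalizedDisplacement {S W : E} (hS : ‖S‖ = 1) (h : inner ℝ W S = (0 : ℝ)) :
    ‖S + normalizedDisplacement S W‖ = 1 := by
  have h1 : S + normalizedDisplacement S W = (√(1 + ‖W‖ ^ 2))⁻¹ • (S + W) := by
    rw [normalizedDisplacement]; module
  have h2 : ‖S + W‖ = √(1 + ‖W‖ ^ 2) := by
    have := norm_add_sq_real S W
    rw [real_inner_comm, h, hS] at this
    rw [← Real.sqrt_sq (norm_nonneg (S + W)), this]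
    congr 1; ring
  have h3 : 0 < √(1 + ‖W‖ ^ 2) := Real.sqrt_pos.2 (by positivity)
  rw [h1, norm_smul, h2, Real.norm_of_nonneg (by positivity), inv_mul_cancel₀ h3.ne']

theorem contDiff_normalizedDisplacement {X : Type*} [NormedAddCommGroup X] [NormedSpace ℝ X]
    {S W : X → E} (hS : ContDiff ℝ ∞ S) (hW : ContDiff ℝ ∞ W) :
    ContDiff ℝ ∞ fun p => normalizedDisplacement (S p) (W p) := by
  have hq : ContDiff ℝ ∞ fun p => (√(1 + ‖W p‖ ^ 2))⁻¹ :=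
    ((contDiff_const.add (hW.norm_sq ℝ)).sqrt fun p => by positivity).inv fun p =>
      (Real.sqrt_pos.2 (by positivity)).ne'
  exact ((hq.sub contDiff_const).smul hS).add (hq.smul hW)

/-- The normalizing factor depends on `‖W‖²`, so renormalization has no first-order effect where `W
= 0`. -/
theorem hasDerivAt_normalizedDisplacement (S : E) {W : ℝ → E} {W' : E} {s : ℝ}
    (hW : HasDerivAt W W' s) (h0 : W s = 0) :
    HasDerivAt (fun t => normalizedDisplacement S (W t)) W' s := by
  have h1 : HasDerivAt (fun t => 1 + ‖W t‖ ^ 2) 0 s := by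
    simpa [h0] using (hW.norm_sq).const_add 1
  have h2 : HasDerivAt (fun t => (√(1 + ‖W t‖ ^ 2))⁻¹) 0 s := by
    refine ((h1.sqrt (by positivity)).fun_inv (Real.sqrt_pos.2 (by positivity)).ne').congr_deriv ?_
    simp
  have h3 := ((h2.sub_const 1).smul_const S).add (h2.smul hW)
  refine h3.congr_deriv ?_
  simp [h0]

end Perturbation

theorem exists_margin {a b : ℝ} (hab : a < b) {C : Set ℝ} (hC : IsCompact C) (h : C ⊆ Ioo a b) :
    ∃ δ > 0, δ < (b - a) / 2 ∧ C ⊆ Ioo (a + δ) (b - δ) := by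
  obtain ⟨r, hr, hrC⟩ := hC.exists_forall_le' (f := fun x => min (x - a) (b - x)) (a := 0)
    (by fun_prop) fun x hx => lt_min (sub_pos.2 (h hx).1) (sub_pos.2 (h hx).2)
  refine ⟨min (r / 2) ((b - a) / 4), lt_min (by positivity) (by linarith), ?_, fun x hx => ?_⟩
  · exact (min_le_right _ _).trans_lt (by linarith)
  · have h1 := le_min_iff.1 (hrC x hx)
    have h2 := min_le_left (r / 2) ((b - a) / 4)
    constructor <;> linarith [h1.1, h1.2]

/-- The tangent is smooth only on `[a,b]`, while the parametric integrals above need globally smooth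
integrands. Changing it near the ends is harmless, because the perturbing fields vanish there. -/
theorem exists_contDiff_eqOn_Icc {F : Type*} [NormedAddCommGroup F] [NormedSpace ℝ F] {a b δ : ℝ}
    (hδ : 0 < δ) (hδ' : δ < (b - a) / 2) {f : ℝ → F} (hf : ContDiffOn ℝ ∞ f (Icc a b)) :
    ∃ S : ℝ → F, ContDiff ℝ ∞ S ∧ ∀ x ∈ Icc (a + δ) (b - δ), S x = f x := by
  let ψ : ContDiffBump ((a + b) / 2) :=
    ⟨(b - a) / 2 - δ, (b - a) / 2 - δ / 2, by linarith, by linarith⟩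
  refine ⟨fun x => ψ x • f x, contDiff_smul_of_tsupport_subset hf ψ.contDiff ?_, fun x hx => ?_⟩
  · rw [ψ.tsupport_eq, Real.closedBall_eq_Icc]
    intro x hx
    simp only [ψ, mem_Icc] at hx
    constructor <;> linarith [hx.1, hx.2]
  · show ψ x • f x = f x
    rw [ψ.one_of_mem_closedBall, one_smul]
    rw [Real.closedBall_eq_Icc]
    simp only [ψ, mem_Icc]
    constructor <;> linarith [hx.1, hx.2]

namespace ElasticCurve

section Variation

variable {n : ℕ} {a b : ℝ} {γ : ℝ → EuclideanSpace ℝ (Fin n)}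

/-- Every compactly supported normal field `w₀` is, up to a correction from a fixed family of
normal fields, the variation of the tangent of an admissible variation. -/
theorem exists_isVariation (hab : a < b) (hγ : IsArcLengthCurve a b γ) {δ : ℝ} (hδ : 0 < δ)
    (hδ' : δ < (b - a) / 2) {w₀ : ℝ → EuclideanSpace ℝ (Fin n)} (hw₀ : ContDiff ℝ ∞ w₀)
    (hw₀supp : ∀ x, x ≤ a + δ ∨ b - δ ≤ x → w₀ x = 0)
    (hw₀perp : ∀ x ∈ Icc a b, inner ℝ (w₀ x) (D a b γ x) = (0 : ℝ))
    {φ : ℝ → ℝ} (hφ : ContDiff ℝ ∞ φ) (hφsupp : ∀ x, x ≤ a + δ ∨ b - δ ≤ x → φ x = 0)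
    (hinj : ∀ v : EuclideanSpace ℝ (Fin n),
      ∫ x in a..b, φ x • (v - (inner ℝ v (D a b γ x) : ℝ) • D a b γ x) = 0 → v = 0) :
    ∃ (ε : ℝ) (Γ : ℝ → ℝ → EuclideanSpace ℝ (Fin n)), IsVariation a b γ ε Γ ∧
      (∀ t ∈ Icc (-ε) ε, IsArcLengthCurve a b (Γ t)) ∧
      ∃ v : EuclideanSpace ℝ (Fin n), ∀ x ∈ Icc a b, HasDerivAt (fun t => D a b (Γ t) x)
        (w₀ x + φ x • (v - (inner ℝ v (D a b γ x) : ℝ) • D a b γ x)) 0 := by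
  obtain ⟨S, hS, hSγ⟩ := exists_contDiff_eqOn_Icc hδ hδ' (hγ.1.D hab)
  set W : ℝ → EuclideanSpace ℝ (Fin n) → ℝ → EuclideanSpace ℝ (Fin n) :=
    fun t v x => t • w₀ x + φ x • (v - (inner ℝ v (S x) : ℝ) • S x) with hW
  set K : (ℝ × EuclideanSpace ℝ (Fin n)) × ℝ → EuclideanSpace ℝ (Fin n) :=
    fun p => normalizedDisplacement (S p.2) (W p.1.1 p.1.2 p.2) with hK
  have hWS : ContDiff ℝ ∞ fun p : (ℝ × EuclideanSpace ℝ (Fin n)) × ℝ => W p.1.1 p.1.2 p.2 := by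
    have h2 : ContDiff ℝ ∞ fun p : (ℝ × EuclideanSpace ℝ (Fin n)) × ℝ => S p.2 :=
      hS.comp contDiff_snd
    have h1 : ContDiff ℝ ∞ fun p : (ℝ × EuclideanSpace ℝ (Fin n)) × ℝ => p.1.2 := by fun_prop
    exact ((contDiff_fst.fst).smul (hw₀.comp contDiff_snd)).add
      ((hφ.comp contDiff_snd).smul (h1.sub ((h1.inner ℝ h2).smul h2)))
  have hKs : ContDiff ℝ ∞ K :=
    contDiff_normalizedDisplacement (hS.comp contDiff_snd) hWS
  have hWoff : ∀ t v x, x ≤ a + δ ∨ b - δ ≤ x → W t v x = 0 := fun t v x hx => by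
    simp [hW, hw₀supp x hx, hφsupp x hx]
  have hKoff : ∀ p x, x ≤ a + δ ∨ b - δ ≤ x → K (p, x) = 0 := fun p x hx => by
    simp only [hK, hWoff _ _ x hx, normalizedDisplacement_zero]
  have hon : ∀ x, ¬(x ≤ a + δ ∨ b - δ ≤ x) → S x = D a b γ x := fun x hx => by
    rw [not_or, not_le, not_le] at hx
    exact hSγ x ⟨hx.1.le, hx.2.le⟩
  have hφS : ∀ v x, φ x • (v - (inner ℝ v (S x) : ℝ) • S x) =
      φ x • (v - (inner ℝ v (D a b γ x) : ℝ) • D a b γ x) := fun v x => by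
    by_cases hx : x ≤ a + δ ∨ b - δ ≤ x
    · rw [hφsupp x hx, zero_smul, zero_smul]
    · rw [hon x hx]
  have hKγ : ∀ t v x, K ((t, v), x) = normalizedDisplacement (D a b γ x) (W t v x) :=
    fun t v x => by
      by_cases hx : x ≤ a + δ ∨ b - δ ≤ x
      · rw [hKoff _ x hx, hWoff _ _ x hx, normalizedDisplacement_zero]
      · simp only [hK, hon x hx]
  have hWperp : ∀ t v, ∀ x ∈ Icc a b, inner ℝ (W t v x) (D a b γ x) = (0 : ℝ) := by
    intro t v x hx
    simp only [hW, hφS]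
    rw [inner_add_left, real_inner_smul_left, real_inner_smul_left, hw₀perp x hx, inner_sub_left,
      real_inner_smul_left, real_inner_self_eq_norm_sq, hγ.2 x hx]
    ring
  have hW0 : ∀ x, W 0 0 x = 0 := fun x => by simp [hW]
  have hK0 : ∀ x, K (0, x) = 0 := fun x => by
    simp only [hK, Prod.fst_zero, Prod.snd_zero, hW0, normalizedDisplacement_zero]
  -- `G (t, v)` is the displacement of the end point; its zeros give variations that close up. Its
  -- `v`-derivative at `0` is the map assumed injective in `hinj`.
  set G : ℝ × EuclideanSpace ℝ (Fin n) → EuclideanSpace ℝ (Fin n) :=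
    fun p => ∫ x in a..b, K (p, x) with hG
  have hGs : ContDiff ℝ ∞ G := contDiff_intervalIntegral_param hKs a b
  have hG0 : G 0 = 0 := by simp [hG, hK0]
  have hK1 : ContDiff ℝ 1 K := hKs.of_le (by simp)
  have hGd : ∀ v, fderiv ℝ G 0 (0, v) =
      ∫ x in a..b, φ x • (v - (inner ℝ v (D a b γ x) : ℝ) • D a b γ x) := by
    intro v
    rw [(hasFDerivAt_intervalIntegral_param hK1 a b 0).fderiv,
      ContinuousLinearMap.intervalIntegral_apply]
    · refine intervalIntegral.integral_congr fun x _ => ?_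
      have h1 : HasDerivAt (fun s : ℝ => ((((0 : ℝ), s • v), x) :
          (ℝ × EuclideanSpace ℝ (Fin n)) × ℝ)) ((0, v), 0) 0 := by
        refine ((hasDerivAt_const _ _).prodMk ?_).prodMk (hasDerivAt_const _ _)
        simpa using (hasDerivAt_id (0 : ℝ)).smul_const v
      have h2 : HasDerivAt (fun s : ℝ => K (((0 : ℝ), s • v), x))
          (fderiv ℝ K (0, x) ((0, v), 0)) 0 := by
        refine HasFDerivAt.comp_hasDerivAt_of_eq (f := fun s : ℝ => (((0 : ℝ), s • v), x)) 0
          (hKs.differentiable (by simp) (0, x)).hasFDerivAt h1 ?_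
        simp only [zero_smul, Prod.mk_zero_zero]
      have h3 : HasDerivAt (fun s : ℝ => W 0 (s • v) x)
          (φ x • (v - (inner ℝ v (S x) : ℝ) • S x)) 0 := by
        have : (fun s : ℝ => W 0 (s • v) x) =
            fun s => s • (φ x • (v - (inner ℝ v (S x) : ℝ) • S x)) := by
          funext s
          simp only [hW, real_inner_smul_left]
          module
        rw [this]
        simpa using (hasDerivAt_id (0 : ℝ)).smul_const
          (φ x • (v - (inner ℝ v (S x) : ℝ) • S x))
      have h4 := hasDerivAt_normalizedDisplacement (S x) h3 (by simp [hW])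
      rw [hφS] at h4
      exact h2.unique h4
    · refine Continuous.intervalIntegrable ?_ _ _
      exact ((hK1.continuous_fderiv one_ne_zero).comp (Continuous.prodMk_right 0)).clm_comp
        continuous_const
  obtain ⟨ε, hε, v, hv, hv0, hGv⟩ := exists_contDiffOn_implicit hGs hG0
    fun v h => hinj v (by rw [← hGd v, h])
  have hI0 : Icc (-ε) ε ∈ 𝓝 (0 : ℝ) := Icc_mem_nhds (by linarith) hε
  have hKc : ∀ t, Continuous fun y => K ((t, v t), y) := fun t =>
    hKs.continuous.comp (Continuous.prodMk_right _)
  set Γ : ℝ → ℝ → EuclideanSpace ℝ (Fin n) :=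
    fun t x => γ x + ∫ y in a..x, K ((t, v t), y) with hΓ
  have hΓsm : ContDiffOn ℝ ∞ (fun p : ℝ × ℝ => Γ p.1 p.2) (Icc (-ε) ε ×ˢ Icc a b) := by
    refine ContDiffOn.add (ContDiffOn.comp hγ.1 contDiffOn_snd fun p hp => hp.2) ?_
    exact (contDiff_primitive_param hKs a).comp_contDiffOn
      (f := fun p : ℝ × ℝ => ((p.1, v p.1), p.2))
      ((contDiffOn_fst.prodMk (hv.comp contDiffOn_fst fun p hp => hp.1)).prodMk contDiffOn_snd)
  have hΓd : ∀ t, ∀ x ∈ Icc a b, D a b (Γ t) x = D a b γ x + K ((t, v t), x) := fun t x hx =>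
    D_eq hab hx ((hγ.1.hasDerivWithinAt hx).add
      ((hKc t).integral_hasStrictDerivAt a x).hasDerivAt.hasDerivWithinAt)
  refine ⟨ε, Γ, ⟨hε, hΓsm, fun x _ => ?_, δ, hδ, fun t ht x hx hxδ => ?_⟩,
    fun t ht => ⟨?_, fun x hx => ?_⟩, deriv v 0, fun x hx => ?_⟩
  · simp only [hΓ, hv0, Prod.mk_zero_zero, hK0, intervalIntegral.integral_zero, add_zero]
  · simp only [hΓ, add_eq_left]
    rcases hxδ with h | h
    · rw [intervalIntegral.integral_congr (g := fun _ => 0), intervalIntegral.integral_zero]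
      intro y hy
      rw [uIcc_of_le hx.1] at hy
      exact hKoff _ y (Or.inl (hy.2.trans h))
    -- Beyond `b - δ` the integrand vanishes, so the integral up to `x` is already the full one, `G
    -- (t, v t) = 0`.
    · have h1 := intervalIntegral.integral_add_adjacent_intervals
        ((hKc t).intervalIntegrable (μ := volume) a x) ((hKc t).intervalIntegrable x b)
      rw [intervalIntegral.integral_congr (a := x) (g := fun _ => 0) (fun y hy => by
        rw [uIcc_of_le hx.2] at hy
        exact hKoff _ y (Or.inr (h.trans hy.1))), intervalIntegral.integral_zero, add_zero] at h1
      rw [h1]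
      exact hGv t ht
  · exact ContDiffOn.comp hΓsm (f := fun x => (t, x)) (by fun_prop) fun x hx => ⟨ht, hx⟩
  · rw [hΓd t x hx, hKγ]
    exact norm_add_normalizedDisplacement (hγ.2 x hx) (hWperp _ _ x hx)
  · have hvd : HasDerivAt v (deriv v 0) 0 :=
      ((hv.contDiffAt hI0).differentiableAt (by simp)).hasDerivAt
    have hWd : HasDerivAt (fun t => W t (v t) x)
        (w₀ x + φ x • (deriv v 0 - (inner ℝ (deriv v 0) (S x) : ℝ) • S x)) 0 := by
      have h1 := (hvd.inner ℝ (hasDerivAt_const (0 : ℝ) (S x))).smul_const (S x)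
      have h2 := ((hasDerivAt_id (0 : ℝ)).smul_const (w₀ x)).add ((hvd.sub h1).const_smul (φ x))
      refine h2.congr_deriv ?_
      simp
    have h3 := (hasDerivAt_normalizedDisplacement (D a b γ x) hWd
      (by simp only [hv0, hW0])).const_add (D a b γ x)
    rw [hφS] at h3
    refine h3.congr_of_eventuallyEq (Eventually.of_forall fun t => ?_)
    simp only [hΓd t x hx, hKγ]

end Variation

variable {m : ℕ} {a b : ℝ} {γ : ℝ → EuclideanSpace ℝ (Fin (m + 1))} {ϱ : ℝ → ℝ}
  {N : Fin m → ℝ → EuclideanSpace ℝ (Fin (m + 1))} {κ : ℝ → EuclideanSpace ℝ (Fin m)}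

/-- Normal corrections supported near a point of nonzero curvature span all displacements of the
end point. -/
theorem eq_zero_of_integral_normal_eq_zero (hab : a < b) (hγ : IsArcLengthCurve a b γ)
    (hN : IsParallelFrame a b γ N) (hκ : IsCurvatureFunction a b γ N κ) {x₀ : ℝ}
    (hx₀ : x₀ ∈ Ioo a b) (hκ₀ : κ x₀ ≠ 0) {φ : ℝ → ℝ} (hφ : Continuous φ) (hφ0 : ∀ x, 0 ≤ φ x)
    (hφ1 : 0 < φ x₀) (v : EuclideanSpace ℝ (Fin (m + 1)))
    (h : ∫ x in a..b, φ x • (v - (inner ℝ v (D a b γ x) : ℝ) • D a b γ x) = 0) : v = 0 := by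
  have hTc : ContinuousOn (D a b γ) (Icc a b) := (hγ.1.D hab).continuousOn
  -- Pairing the hypothesis with `v` gives `∫ φ ‖v - ⟨v,T⟩T‖² = 0`, so `v` is parallel to `T`
  -- wherever `φ > 0`.
  have hsq : ∀ x ∈ Icc a b, inner ℝ v (v - (inner ℝ v (D a b γ x) : ℝ) • D a b γ x) =
      ‖v - (inner ℝ v (D a b γ x) : ℝ) • D a b γ x‖ ^ 2 := fun x hx => by
    rw [norm_sub_sq_real, norm_smul, hγ.2 x hx, inner_sub_right, real_inner_smul_right,
      real_inner_self_eq_norm_sq, Real.norm_eq_abs, mul_one, sq_abs]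
    ring
  have hc : ContinuousOn (fun x => φ x • (v - (inner ℝ v (D a b γ x) : ℝ) • D a b γ x))
      (Icc a b) := by fun_prop
  have hint : IntervalIntegrable (fun x => φ x • (v - (inner ℝ v (D a b γ x) : ℝ) • D a b γ x))
      volume a b := ContinuousOn.intervalIntegrable (by rwa [uIcc_of_le hab.le])
  have h1 := ((innerSL ℝ) v).intervalIntegral_comp_comm hint
  simp only [innerSL_apply_apply, h, inner_zero_right, real_inner_smul_right] at h1
  have hzero : ∀ x ∈ Icc a b,
      φ x * inner ℝ v (v - (inner ℝ v (D a b γ x) : ℝ) • D a b γ x) = 0 := by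
    by_contra! hne
    obtain ⟨x, hx, hne⟩ := hne
    have hnn : ∀ x ∈ Icc a b,
        0 ≤ φ x * inner ℝ v (v - (inner ℝ v (D a b γ x) : ℝ) • D a b γ x) := fun x hx => by
      rw [hsq x hx]; exact mul_nonneg (hφ0 x) (sq_nonneg _)
    refine (intervalIntegral.integral_pos hab (by fun_prop)
      (fun x hx => hnn x (Ioc_subset_Icc_self hx))
      ⟨x, hx, lt_of_le_of_ne (hnn x hx) hne.symm⟩).ne' h1
  have hx₀' := Ioo_subset_Icc_self hx₀
  have hev : ∀ᶠ x in 𝓝 x₀, v = (inner ℝ v (D a b γ x) : ℝ) • D a b γ x := by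
    filter_upwards [Icc_mem_nhds hx₀.1 hx₀.2, (hφ.tendsto x₀).eventually (lt_mem_nhds hφ1)] with x hx hp
    have h2 := hzero x hx
    rw [hsq x hx] at h2
    have h3 := (mul_eq_zero.1 h2).resolve_left hp.ne'
    exact sub_eq_zero.1 (norm_eq_zero.1 (pow_eq_zero_iff two_ne_zero |>.1 h3))
  obtain ⟨i, hi⟩ : ∃ i, κ x₀ i ≠ 0 := by
    by_contra! hz
    exact hκ₀ (by ext i; exact hz i)
  -- Near `x₀` one has `⟨v, Nᵢ⟩ = 0`; differentiating gives `κᵢ⟨v, T⟩ = 0`, and `κᵢ ≠ 0` at `x₀`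
  -- kills the remaining component of `v`.
  have hd := ((hasDerivAt_const x₀ v).inner ℝ
    (((hN.parallel i).1.hasDerivWithinAt hx₀').hasDerivAt (Icc_mem_nhds hx₀.1 hx₀.2)))
  have hd0 := hd.unique ((hasDerivAt_const x₀ (0 : ℝ)).congr_of_eventuallyEq (by
    filter_upwards [hev, Icc_mem_nhds hx₀.1 hx₀.2] with x hx hx'
    rw [hx, real_inner_smul_left, real_inner_comm (N i x) (D a b γ x),
      hN.inner_tangent hγ hx', mul_zero]))
  rw [hN.D_normal hab hγ hκ hx₀', real_inner_smul_right, inner_zero_left, add_zero] at hd0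
  rw [hev.self_of_nhds, (mul_eq_zero.1 hd0).resolve_left hi, zero_smul]

end ElasticCurve

/-! ### The Lagrange multiplier theorem and the conclusion. -/

namespace ElasticCurve

variable {m : ℕ} {a b : ℝ} {γ : ℝ → EuclideanSpace ℝ (Fin (m + 1))} {ϱ : ℝ → ℝ}
  {N : Fin m → ℝ → EuclideanSpace ℝ (Fin (m + 1))} {κ : ℝ → EuclideanSpace ℝ (Fin m)}

/-- The total displacement produced by the normal fields `φ(v - ⟨v,T⟩T)`, as a linear map in `v`. -/
noncomputable def normalIntegral (hab : a < b) (hγ : IsArcLengthCurve a b γ) {φ : ℝ → ℝ} (hφ : Continuous φ) :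
    EuclideanSpace ℝ (Fin (m + 1)) →ₗ[ℝ] EuclideanSpace ℝ (Fin (m + 1)) where
  toFun v := ∫ x in a..b, φ x • (v - (inner ℝ v (D a b γ x) : ℝ) • D a b γ x)
  map_add' v w := by
    have hTc : ContinuousOn (D a b γ) (Icc a b) := (hγ.1.D hab).continuousOn
    rw [← intervalIntegral.integral_add]
    · refine intervalIntegral.integral_congr fun x _ => ?_
      simp only [inner_add_left]
      module
    all_goals
      refine ContinuousOn.intervalIntegrable ?_
      rw [uIcc_of_le hab.le]
      fun_prop
  map_smul' r v := by
    rw [RingHom.id_apply, ← intervalIntegral.integral_smul]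
    refine intervalIntegral.integral_congr fun x _ => ?_
    simp only [real_inner_smul_left]
    module

/-- The Lagrange multiplier theorem for elastic curves: the normal part of `(ϱT')'` is that of a
constant vector, provided the curve bends somewhere. -/
theorem IsElastic.exists_const (hab : a < b) (hγ : IsArcLengthCurve a b γ)
    (hϱ : SmoothOn a b ϱ) (hN : IsParallelFrame a b γ N) (hκ : IsCurvatureFunction a b γ N κ)
    (hel : IsElastic a b ϱ γ) {x₀ : ℝ} (hx₀ : x₀ ∈ Ioo a b) (hκ₀ : κ x₀ ≠ 0) :
    ∃ c : EuclideanSpace ℝ (Fin (m + 1)), ∀ x ∈ Icc a b, ∀ i,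
      inner ℝ (D a b (fun y => ϱ y • D a b (D a b γ) y) x - c) (N i x) = 0 := by
  obtain ⟨φ, hφt, hφc, hφ, hφr, hφ1⟩ := exists_contDiff_tsupport_subset (n := ⊤)
    (isOpen_Ioo.mem_nhds hx₀)
  have hφ0 : ∀ x, 0 ≤ φ x := fun x => (hφr (mem_range_self x)).1
  have hTs := hγ.1.D hab
  have hBs : SmoothOn a b (D a b (fun y => ϱ y • D a b (D a b γ) y)) :=
    SmoothOn.D hab (ContDiffOn.smul hϱ (hTs.D hab))
  set B := D a b (fun y => ϱ y • D a b (D a b γ) y) with hB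
  have hinj := eq_zero_of_integral_normal_eq_zero hab hγ hN hκ hx₀ hκ₀ hφ.continuous hφ0
    (by rw [hφ1]; exact one_pos)
  set A := normalIntegral hab hγ hφ.continuous with hA
  have hAapp : ∀ v, A v = ∫ x in a..b, φ x • (v - (inner ℝ v (D a b γ x) : ℝ) • D a b γ x) :=
    fun v => rfl
  have hAinj : Function.Injective A := by
    rw [injective_iff_map_eq_zero]
    exact fun v hv => hinj v hv
  have hnormal : ∀ v, SmoothOn a b fun x =>
      φ x • (v - (inner ℝ v (D a b γ x) : ℝ) • D a b γ x) := fun v =>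
    ContDiffOn.smul hφ.contDiffOn
      (contDiffOn_const.sub ((contDiffOn_const.inner ℝ hTs).smul hTs))
  -- the energy variation of the corrections, represented by a vector
  let ℓ : EuclideanSpace ℝ (Fin (m + 1)) →ₗ[ℝ] ℝ :=
    { toFun := fun v => ∫ x in a..b,
        inner ℝ (B x) (φ x • (v - (inner ℝ v (D a b γ x) : ℝ) • D a b γ x))
      map_add' := fun v w => by
        rw [← intervalIntegral.integral_add]
        · refine intervalIntegral.integral_congr fun x _ => ?_
          simp only [inner_add_left]
          rw [← inner_add_right]
          congr 1
          module
        all_goals exact SmoothOn.intervalIntegrable hab (hBs.inner ℝ (hnormal _))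
      map_smul' := fun r v => by
        rw [RingHom.id_apply, ← intervalIntegral.integral_smul]
        refine intervalIntegral.integral_congr fun x _ => ?_
        simp only [real_inner_smul_left, smul_eq_mul]
        rw [← real_inner_smul_right (B x)]
        congr 1
        module }
  let Ae := LinearEquiv.ofInjectiveEndo A hAinj
  -- As `A` is invertible, `⟨c, A v⟩ = ℓ v` determines `c`, independently of any test field.
  let c := (InnerProductSpace.toDual ℝ (EuclideanSpace ℝ (Fin (m + 1)))).symm
    (LinearMap.toContinuousLinearMap (ℓ ∘ₗ (Ae.symm : _ →ₗ[ℝ] _)))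
  have hc : ∀ v, inner ℝ c (A v) = ℓ v := fun v => by
    rw [InnerProductSpace.toDual_symm_apply]
    simp only [LinearMap.coe_toContinuousLinearMap', LinearMap.coe_comp, Function.comp_apply,
      LinearEquiv.coe_coe]
    congr 1
    exact Ae.symm_apply_apply v
  refine ⟨c, fun x hx i => ?_⟩
  have hNs := (hN.parallel i).1
  have hfs : SmoothOn a b fun x => (inner ℝ (B x - c) (N i x) : ℝ) :=
    (hBs.sub contDiffOn_const).inner ℝ hNs
  -- Fundamental lemma of the calculus of variations, tested with the normal fields `g Nᵢ`.
  have hae : ∀ᵐ x ∂volume, x ∈ Ioo a b → (inner ℝ (B x - c) (N i x) : ℝ) = 0 := by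
    refine isOpen_Ioo.ae_eq_zero_of_integral_contDiff_smul_eq_zero ?_ ?_
    · exact (hfs.continuousOn.mono Ioo_subset_Icc_self).locallyIntegrableOn measurableSet_Ioo
    · intro g hg hgc hgt
      obtain ⟨δ, hδ, hδ', hsub⟩ := exists_margin hab (hφc.union hgc) (union_subset hφt hgt)
      have hoff : ∀ {h : ℝ → ℝ}, tsupport h ⊆ tsupport φ ∪ tsupport g →
          ∀ x, x ≤ a + δ ∨ b - δ ≤ x → h x = 0 := fun {h} hh x hx => by
        refine image_eq_zero_of_notMem_tsupport fun hxt => ?_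
        have := hsub (hh hxt)
        rcases hx with hx | hx
        · exact absurd this.1 hx.not_gt
        · exact absurd this.2 hx.not_gt
      have hgN : ContDiff ℝ ∞ fun x => g x • N i x := contDiff_smul_of_tsupport_subset hNs hg hgt
      obtain ⟨ε, Γ, hV, hΓ, v, hv⟩ := exists_isVariation hab hγ hδ hδ' hgN
        (fun x hx => by rw [hoff subset_union_right x hx, zero_smul])
        (fun x hx => by rw [real_inner_smul_left, hN.inner_tangent hγ hx, mul_zero])
        hφ (fun x hx => hoff subset_union_left x hx) hinj
      obtain ⟨w, hw, hwd, -, hwint, hE⟩ := exists_firstVariation hab hϱ hV hΓ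
      have hw' : ∀ x ∈ Icc a b, w x =
          g x • N i x + φ x • (v - (inner ℝ v (D a b γ x) : ℝ) • D a b γ x) := fun x hx =>
        (hwd x hx).unique (hv x hx)
      have hgNi := SmoothOn.intervalIntegrable hab (hgN.contDiffOn (s := Icc a b))
      have h1 : ∫ x in a..b, g x • N i x = -A v := by
        rw [eq_neg_iff_add_eq_zero, hAapp, ← intervalIntegral.integral_add hgNi
          (SmoothOn.intervalIntegrable hab (hnormal v)), ← hwint]
        refine intervalIntegral.integral_congr fun x hx => ?_
        rw [uIcc_of_le hab.le] at hx
        exact (hw' x hx).symm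
      have hBg : IntervalIntegrable (fun x => (inner ℝ (B x) (g x • N i x) : ℝ)) volume a b :=
        SmoothOn.intervalIntegrable hab (hBs.inner ℝ hgN.contDiffOn)
      -- Closing gives `∫ g Nᵢ = -A v` and criticality gives `∫ ⟨B, g Nᵢ⟩ = -ℓ v`. By the choice of
      -- `c` the unknown correction `v` cancels, leaving `∫ g ⟨B - c, Nᵢ⟩ = 0`.
      have h2 : ∫ x in a..b, (inner ℝ (B x) (g x • N i x) : ℝ) = -ℓ v := by
        rw [eq_neg_iff_add_eq_zero]
        have h3 := neg_eq_zero.1 (hE.unique (hel ε Γ hV hΓ))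
        rw [← h3]
        refine (intervalIntegral.integral_add hBg
          (SmoothOn.intervalIntegrable hab (hBs.inner ℝ (hnormal v)))).symm.trans ?_
        refine intervalIntegral.integral_congr fun x hx => ?_
        rw [uIcc_of_le hab.le] at hx
        rw [hw' x hx, inner_add_right]
      have h3 := ((innerSL ℝ) c).intervalIntegral_comp_comm hgNi
      simp only [innerSL_apply_apply] at h3
      rw [h1, inner_neg_right, hc] at h3
      have hcg : IntervalIntegrable (fun x => (inner ℝ c (g x • N i x) : ℝ)) volume a b :=
        SmoothOn.intervalIntegrable hab (contDiffOn_const.inner ℝ hgN.contDiffOn)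
      rw [← intervalIntegral.integral_eq_integral_of_support_subset (a := a) (b := b)]
      · rw [← sub_eq_zero.2 (h2.trans h3.symm), ← intervalIntegral.integral_sub hBg hcg]
        refine intervalIntegral.integral_congr fun x _ => ?_
        simp only [inner_sub_left, real_inner_smul_right, smul_eq_mul]
        ring
      · intro x hx
        have hgx : g x ≠ 0 := fun h => hx (by simp [h])
        exact Ioo_subset_Ioc_self (hgt (subset_tsupport g hgx))
  have hae' : (fun x => (inner ℝ (B x - c) (N i x) : ℝ)) =ᵐ[volume.restrict (Icc a b)]
      fun _ => 0 := by
    rw [← restrict_Ioo_eq_restrict_Icc]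
    exact (ae_restrict_iff' measurableSet_Ioo).2 hae
  exact Measure.eqOn_Icc_of_ae_eq volume hab.ne hae' hfs.continuousOn continuousOn_const hx

/-- On a straight segment normal corrections cannot move the end point along the line, so the
multiplier argument breaks down; but then `κ = 0` and `Λ = 0` works. -/
theorem IsElastic.hasMultiplier (hab : a < b) (hγ : IsArcLengthCurve a b γ)
    (hϱ : SmoothOn a b ϱ) (hN : IsParallelFrame a b γ N) (hκ : IsCurvatureFunction a b γ N κ)
    (hel : IsElastic a b ϱ γ) : HasMultiplier a b ϱ κ := by
  by_cases h : ∃ x ∈ Ioo a b, κ x ≠ 0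
  · obtain ⟨x₀, hx₀, hκ₀⟩ := h
    obtain ⟨c, hc⟩ := hel.exists_const hab hγ hϱ hN hκ hx₀ hκ₀
    exact hasMultiplier_of_const hab hγ hϱ hN hκ c hc
  · push Not at h
    have hzero : EqOn κ (fun _ => 0) (Icc a b) :=
      EqOn.of_subset_closure (s := Ioo a b) h hκ.1.continuousOn continuousOn_const
        Ioo_subset_Icc_self (closure_Ioo hab.ne).ge
    have hD0 : ∀ {F : Type} [NormedAddCommGroup F] [NormedSpace ℝ F], ∀ x ∈ Icc a b,
        D a b (fun _ => (0 : F)) x = 0 := fun x hx => D_eq hab hx (hasDerivWithinAt_const x _ _)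
    refine ⟨fun _ => 0, contDiffOn_const, fun x hx => ⟨?_, ?_⟩⟩
    · rw [D_congr (g := fun _ => 0) (fun y hy => ?_) hx, hD0 x hx, hzero hx]
      · simp
      · rw [D_congr (g := fun _ => 0) (fun z hz => by rw [hzero hz, smul_zero]) hy, hD0 y hy]
    · rw [hD0 x hx, hzero hx]
      simp

end ElasticCurve

theorem theorem4p4 {m : ℕ} (hm : 1 ≤ m) {a b : ℝ} (hab : a < b)
    (γ : ℝ → EuclideanSpace ℝ (Fin (m + 1))) (hγ : ElasticCurve.IsArcLengthCurve a b γ)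
    (ϱ : ℝ → ℝ) (hϱ : ElasticCurve.SmoothOn a b ϱ) (hϱ_pos : ∀ x ∈ Set.Icc a b, 0 < ϱ x)
    (N : Fin m → ℝ → EuclideanSpace ℝ (Fin (m + 1))) (hN : ElasticCurve.IsParallelFrame a b γ N)
    (κ : ℝ → EuclideanSpace ℝ (Fin m)) (hκ : ElasticCurve.IsCurvatureFunction a b γ N κ) :
    ElasticCurve.IsElastic a b ϱ γ ↔
      ∃ Λ : ℝ → ℝ, ElasticCurve.SmoothOn a b Λ ∧ ∀ x ∈ Set.Icc a b,
        ElasticCurve.D a b (ElasticCurve.D a b (fun y => ϱ y • κ y)) x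
            + ((1 / 2) * ϱ x * inner ℝ (κ x) (κ x)) • κ x - Λ x • κ x = 0 ∧
        ElasticCurve.D a b Λ x + (1 / 2) * ElasticCurve.D a b ϱ x * inner ℝ (κ x) (κ x) = 0 := by
  exact ⟨fun h => h.hasMultiplier hab hγ hϱ hN hκ,
    fun h => ElasticCurve.HasMultiplier.isElastic hab hγ hϱ hN hκ h⟩
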